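/- **Theorem.** Let formulas of conditional logic be given by $A, B ::= \bot \mid p \mid \neg A \mid A \land B \mid (A \Rightarrow B)$, where $p$ ranges over a countably infinite set of propositional variables $p_0, p_1, \dots$, and let $\top,\lor, \to, \leftrightarrow$ be the usual propositional abbreviations. For a set $R$ of rules (axioms being rules without premises), a formula is *provable in the Hilbert system given by $R$* if it belongs to the least set of formulas that contains all substitution instances of propositional tautologies and is closed under modus ponens and under the rules in $R$. Let - $\mathsf{CKCEM}$ be the Hilbert system given by all instances of $$(\mathsf{RCEA})\ \frac{A \leftrightarrow A'}{(A \Rightarrow B) \leftrightarrow (A' \Rightarrow B)}, \qquad (\mathsf{RCK})\ \frac{B_1 \land \dots \land B_n \to B}{(A \Rightarrow B_1) \land \dots \land (A \Rightarrow B_n) \to (A \Rightarrow B)}\ (n \ge 0),$$ $$(\mathsf{CEM})\ (A \Rightarrow B) \lor (A \Rightarrow \neg B);$$ - $\mathsf{CKIDCEM}$ be its extension by all instances of the axiom $(\mathsf{ID})\ A \Rightarrow A$. Then provability in $\mathsf{CKCEM}$ and provability in $\mathsf{CKIDCEM}$ are both in coNP. That is, for each of the two systems, the set of strings that encode a provable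 formula (formulas being written as strings over a finite alphabet in prefix notation, with variable indices in binary) has its complement in NP. -/

import Mathlib

namespace CondLogic

/-- Formulas of conditional logic over a set `V` of propositional variables:
`A, B ::= ⊥ | p | ¬A | A ∧ B | A ⇒ B`. -/
inductive Form (V : Type) : Type
  | bot : Form V
  | var : V → Form V
  | neg : Form V → Form V
  | and : Form V → Form V → Form V
  | cond : Form V → Form V → Form V
  deriving DecidableEq

namespace Form

variable {V : Type}

/-- `⊤` -/
def top : Form V := neg bot

/-- `A ∨ B` -/
def or (A B : Form V) : Form V := neg (and (neg A) (neg B))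

/-- Material implication `A → B`. -/
def imp (A B : Form V) : Form V := neg (and A (neg B))

/-- `A ↔ B` -/
def iff (A B : Form V) : Form V := and (imp A B) (imp B A)

/-- The conjunction of a finite list of formulas; the empty conjunction is `⊤`. -/
def bigAnd : List (Form V) → Form V
  | [] => top
  | A :: l => and A (bigAnd l)

/-- Uniform substitution. -/
def subst (σ : V → Form V) : Form V → Form V
  | bot => bot
  | var p => σ p
  | neg A => neg (subst σ A)
  | and A B => and (subst σ A) (subst σ B)
  | cond A B => cond (subst σ A) (subst σ B)

/-- Propositional truth value of a formula, where variables and conditionals `A ⇒ B` are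
propositional atoms whose truth values are given by `v`. -/
def PropTrue (v : Form V → Prop) : Form V → Prop
  | bot => False
  | var p => v (var p)
  | neg A => ¬ PropTrue v A
  | and A B => PropTrue v A ∧ PropTrue v B
  | cond A B => v (cond A B)

/-- Propositional tautologies. -/
def IsTautology (A : Form V) : Prop := ∀ v : Form V → Prop, PropTrue v A

end Form

/-- A rule with finitely many premises and one conclusion. An axiom is a rule without premises. -/
structure Rule (V : Type) where
  premises : List (Form V)
  conclusion : Form V

/-- Derivability in the Hilbert system given by a rule set `R`: the least set of formulas that
contains the substitution instances of propositional tautologies and is closed under modus ponens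
and under the rules in `R`. -/
inductive HDerivable {V : Type} (R : Set (Rule V)) : Form V → Prop
  | taut (A : Form V) (σ : V → Form V) : A.IsTautology → HDerivable R (A.subst σ)
  | mp (A B : Form V) : HDerivable R A → HDerivable R (A.imp B) → HDerivable R B
  | rule (r : Rule V) : r ∈ R → (∀ P ∈ r.premises, HDerivable R P) → HDerivable R r.conclusion

section Rules

variable (V : Type)

/-- `A ↔ A' / (A ⇒ B) ↔ (A' ⇒ B)` -/
def RCEA : Set (Rule V) :=
  {r | ∃ A A' B : Form V, r = ⟨[A.iff A'], (A.cond B).iff (A'.cond B)⟩}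

/-- `B₁ ∧ … ∧ Bₙ → B / (A ⇒ B₁) ∧ … ∧ (A ⇒ Bₙ) → (A ⇒ B)`, for `n ≥ 0` -/
def RCK : Set (Rule V) :=
  {r | ∃ (A B : Form V) (Bs : List (Form V)),
    r = ⟨[(Form.bigAnd Bs).imp B], (Form.bigAnd (Bs.map fun C => A.cond C)).imp (A.cond B)⟩}

/-- Conditional identity `A ⇒ A`. -/
def ID : Set (Rule V) :=
  {r | ∃ A : Form V, r = ⟨[], A.cond A⟩}

/-- Conditional excluded middle `(A ⇒ B) ∨ (A ⇒ ¬B)`. -/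
def CEM : Set (Rule V) :=
  {r | ∃ A B : Form V, r = ⟨[], (A.cond B).or (A.cond B.neg)⟩}

/-- The basic conditional logic. -/
def CK : Set (Rule V) := RCEA V ∪ RCK V

def CKCEM : Set (Rule V) := CK V ∪ CEM V

def CKIDCEM : Set (Rule V) := CK V ∪ ID V ∪ CEM V

end Rules

/-- The input alphabet: the five formula constructors, the binary digits, and an end marker for
the index of a variable. -/
inductive Sym : Type
  | bot | var | neg | and | cond
  | bit (b : Bool)
  | endMark
  deriving DecidableEq, Fintype

/-- Formulas over the variables `p₀, p₁, …` as strings: prefix notation, where the index of a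
variable is written in binary. -/
def Form.encode : Form ℕ → List Sym
  | .bot => [.bot]
  | .var n => .var :: (Computability.encodeNat n).map .bit ++ [.endMark]
  | .neg A => .neg :: A.encode
  | .and A B => .and :: (A.encode ++ B.encode)
  | .cond A B => .cond :: (A.encode ++ B.encode)

/-- The decision problem "is the formula `A` provable in the Hilbert system given by `R`?",
as a set of strings. -/
def provabilityProblem (R : Set (Rule ℕ)) : Set (List Sym) :=
  {x | ∃ A : Form ℕ, A.encode = x ∧ HDerivable R A}

end CondLogic

namespace Complexity

open Computability

/-- `L ∈ NP`: there are a verifier `V`, computed in polynomial time by a (deterministic,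
multi-stack) Turing machine, and a polynomial `p` such that `x ∈ L` iff `V` accepts `(x, w)` for
some certificate `w` of length at most `p(|x|)`. -/
def InNP {Γ : Type} (L : Set (List Γ)) : Prop :=
  ∃ (V : List Γ × List Bool → Bool) (p : Polynomial ℕ),
    Nonempty (Turing.TM2ComputableInPolyTime
      (encodingProd (encodingList Γ) (encodingList Bool)).encode encodeBool V) ∧
    ∀ x : List Γ, x ∈ L ↔ ∃ w : List Bool, w.length ≤ p.eval x.length ∧ V (x, w) = true

/-- `L ∈ coNP`: the complement of `L` is in NP. -/
def InCoNP {Γ : Type} (L : Set (List Γ)) : Prop := InNP Lᶜ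

end Complexity

namespace CondLogic

theorem Form.encode_append_inj : ∀ (A B : Form ℕ) (s t : List Sym),
    A.encode ++ s = B.encode ++ t → A = B ∧ s = t := by
  have hbits : ∀ (l m : List Bool) (s t : List Sym),
      l.map Sym.bit ++ Sym.endMark :: s = m.map Sym.bit ++ Sym.endMark :: t → l = m ∧ s = t := by
    intro l
    induction l with
    | nil => intro m s t h; cases m <;> simp_all
    | cons a l ih =>
      intro m s t h
      cases m with
      | nil => simp at h
      | cons b m =>
        simp only [List.map_cons, List.cons_append, List.cons.injEq, Sym.bit.injEq] at h
        obtain ⟨h1, h2⟩ := ih m s t h.2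
        exact ⟨by rw [h.1, h1], h2⟩
  intro A
  induction A with
  | bot => intro B s t h; cases B <;> simp_all [Form.encode]
  | var n =>
    intro B s t h
    cases B with
    | var m =>
      simp only [Form.encode, List.cons_append, List.append_assoc, List.cons.injEq, true_and,
        List.nil_append] at h
      obtain ⟨h1, h2⟩ := hbits _ _ _ _ h
      refine ⟨?_, h2⟩
      rw [← Computability.decode_encodeNat n, h1, Computability.decode_encodeNat]
    | _ => simp [Form.encode] at h
  | neg A ih =>
    intro B s t h
    cases B with
    | neg B =>
      simp only [Form.encode, List.cons_append, List.cons.injEq, true_and] at h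
      obtain ⟨h1, h2⟩ := ih _ _ _ h
      exact ⟨by rw [h1], h2⟩
    | _ => simp [Form.encode] at h
  | and A A' ih ih' =>
    intro B s t h
    cases B with
    | and B B' =>
      simp only [Form.encode, List.cons_append, List.append_assoc, List.cons.injEq,
        true_and] at h
      obtain ⟨h1, h2⟩ := ih _ _ _ h
      obtain ⟨h3, h4⟩ := ih' _ _ _ h2
      exact ⟨by rw [h1, h3], h4⟩
    | _ => simp [Form.encode] at h
  | cond A A' ih ih' =>
    intro B s t h
    cases B with
    | cond B B' =>
      simp only [Form.encode, List.cons_append, List.append_assoc, List.cons.injEq,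
        true_and] at h
      obtain ⟨h1, h2⟩ := ih _ _ _ h
      obtain ⟨h3, h4⟩ := ih' _ _ _ h2
      exact ⟨by rw [h1, h3], h4⟩
    | _ => simp [Form.encode] at h

/-- Distinct formulas have distinct codes. -/
theorem Form.encode_injective : Function.Injective Form.encode := by
  intro A B h
  exact (Form.encode_append_inj A B [] [] (by simp [h])).1

end CondLogic

/-! ### Selection function semantics and soundness -/

namespace CondLogic

/-! Both systems are complete for models in which a selection function picks, at each world and for
each proposition, at most one world (`CEM`), which lies in the proposition if `ID` is present.
Completeness comes from the canonical model of complete theories (`canon_holds`). An NP certificate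
for unprovability is a polynomial-size part of a countermodel.

Why a small part suffices: a conditional leads to at most one successor, so the evaluation of `A` at
a world visits at most `|A|` pairs of a world and a subformula (`length_trace_le`). Moreover,
conditionals whose antecedents have the same truth set must share their successor. To justify
different successors, the certificate contains, for each pair of subformulas that differ somewhere,
the evaluation of both at one world where they differ. The blocks of signed formulas obtained in
this way satisfy purely local conditions (`isHintikka_certificate`, `exists_refutation`).

Why the local conditions suffice: a certificate need not be well-founded, since a block may be its
own successor. By induction on the depth `d` of conditionals, every block agrees up to depth `d`
with some canonical world (`exists_agree`). A root is added to the canonical model whose successors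
realise blocks up to depth `d - 1`. Antecedents of depth below `d` with equal canonical truth sets
are separated by no block, so one successor block serves both. The theory of the root is again a
canonical world.

The complement also contains the strings that code no formula. Codes are prefix-free, and a string
without a local fault is a prefix or an extension of a code of linear length (`exists_parse`); that
code refutes it if it differs from the string.

The verifier quantifies only over strings cut out of the certificate at its suffixes. Hence it is a
loop program in which every loop runs as often as a fixed clock of linear size says, and such
programs compile to polynomial-time machines (`Cmd.code_correct`, `ProgPred.polyTime`). -/

/-- The two systems: `CKCEM`, and `CKIDCEM` if the flag is set. -/
def system (i : Bool) : Set (Rule ℕ) := if i then CKIDCEM ℕ else CKCEM ℕ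

/-- Selection function models of conditional logic with conditional excluded middle. -/
structure SelModel where
  W : Type
  sel : W → Set W → Option W
  val : W → ℕ → Prop

namespace SelModel

variable (M : SelModel)

/-- Truth of a formula at a world. -/
def Holds : M.W → Form ℕ → Prop
  | _, .bot => False
  | w, .var p => M.val w p
  | w, .neg A => ¬ Holds w A
  | w, .and A B => Holds w A ∧ Holds w B
  | w, .cond A B => ∀ u, M.sel w {v | Holds v A} = some u → Holds u B

/-- The frame condition that corresponds to the axiom `ID`. -/
def Identity : Prop := ∀ w X u, M.sel w X = some u → u ∈ X

variable {M}

theorem holds_imp {w : M.W} {A B : Form ℕ} :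
    M.Holds w (A.imp B) ↔ (M.Holds w A → M.Holds w B) := by
  simp [Form.imp, Holds]

theorem holds_or {w : M.W} {A B : Form ℕ} :
    M.Holds w (A.or B) ↔ (M.Holds w A ∨ M.Holds w B) := by
  simp only [Form.or, Holds]; tauto

theorem holds_iff {w : M.W} {A B : Form ℕ} :
    M.Holds w (A.iff B) ↔ (M.Holds w A ↔ M.Holds w B) := by
  simp only [Form.iff, Holds, holds_imp]; tauto

theorem holds_bigAnd {w : M.W} {l : List (Form ℕ)} :
    M.Holds w (Form.bigAnd l) ↔ ∀ A ∈ l, M.Holds w A := by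
  induction l with
  | nil => simp [Form.bigAnd, Form.top, Holds]
  | cons A l ih => simp [Form.bigAnd, Holds, ih]

/-- A world is a propositional valuation once conditionals count as atoms, so instances of
tautologies hold everywhere. -/
theorem holds_subst {w : M.W} (σ : ℕ → Form ℕ) (A : Form ℕ) :
    M.Holds w (A.subst σ) ↔ A.PropTrue (fun B => M.Holds w (B.subst σ)) := by
  induction A with
  | bot => simp [Form.subst, Form.PropTrue, Holds]
  | var p => simp [Form.subst, Form.PropTrue]
  | neg A ih => simp [Form.subst, Form.PropTrue, Holds, ih]
  | and A B ih ih' => simp [Form.subst, Form.PropTrue, Holds, ih, ih']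
  | cond A B => simp [Form.PropTrue]

/-- `RCEA` holds because the selection depends only on the truth set of the antecedent, `CEM`
because at most one world is selected, and `ID` by the frame condition. -/
theorem sound {i : Bool} (hM : i = true → M.Identity) {A : Form ℕ}
    (h : HDerivable (system i) A) : ∀ w, M.Holds w A := by
  induction h with
  | taut A σ hA => exact fun w => (holds_subst σ A).2 (hA _)
  | mp A B _ _ h1 h2 => exact fun w => holds_imp.1 (h2 w) (h1 w)
  | rule r hr _ ih =>
    intro w
    have hr' : r ∈ RCEA ℕ ∨ r ∈ RCK ℕ ∨ (i = true ∧ r ∈ ID ℕ) ∨ r ∈ CEM ℕ := by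
      cases i <;> simp [system, CKCEM, CKIDCEM, CK] at hr ⊢ <;> tauto
    rcases hr' with ⟨A, A', B, rfl⟩ | ⟨A, B, Bs, rfl⟩ | ⟨hi, A, rfl⟩ | ⟨A, B, rfl⟩
    · have h : {v | M.Holds v A} = {v | M.Holds v A'} := by
        ext v
        exact holds_iff.1 (ih _ (by simp) v)
      simp [holds_iff, Holds, h]
    · simp only [holds_imp, holds_bigAnd, List.mem_map, forall_exists_index, and_imp,
        forall_apply_eq_imp_iff₂]
      intro h u hu
      exact holds_imp.1 (ih _ (by simp) u) (holds_bigAnd.2 fun C hC => h C hC u hu)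
    · exact fun u hu => hM hi _ _ _ hu
    · refine holds_or.2 ?_
      simp only [Holds]
      cases h : M.sel w {v | M.Holds v A} with
      | none => simp
      | some u => simpa using em _

end SelModel

/-! ### Complete theories and the canonical model -/

/-- Complete theories that are closed under derivability: the worlds of the canonical model. -/
structure IsWorld (i : Bool) (T : Set (Form ℕ)) : Prop where
  der : ∀ {A}, HDerivable (system i) A → A ∈ T
  mp : ∀ {A B}, A ∈ T → A.imp B ∈ T → B ∈ T
  neg : ∀ {A}, A.neg ∈ T ↔ A ∉ T

/-- Turns a world of any suitable model into a point of the canonical model; in particular the root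
of an extended model. -/
theorem SelModel.isWorld_theory {M : SelModel} {i : Bool} (hM : i = true → M.Identity) (w : M.W) :
    IsWorld i {A | M.Holds w A} where
  der h := sound hM h w
  mp h1 h2 := holds_imp.1 h2 h1
  neg := Iff.rfl

theorem Form.subst_var (A : Form ℕ) : A.subst Form.var = A := by
  induction A <;> simp_all [Form.subst]

theorem HDerivable.of_taut {R : Set (Rule ℕ)} {A : Form ℕ} (h : A.IsTautology) :
    HDerivable R A := by
  have := HDerivable.taut (R := R) A Form.var h
  rwa [Form.subst_var] at this

theorem mem_system {i : Bool} {r : Rule ℕ}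
    (h : r ∈ RCEA ℕ ∨ r ∈ RCK ℕ ∨ (i = true ∧ r ∈ ID ℕ) ∨ r ∈ CEM ℕ) : r ∈ system i := by
  cases i <;> simp [system, CKCEM, CKIDCEM, CK] at h ⊢ <;> tauto

namespace IsWorld

variable {i : Bool} {T : Set (Form ℕ)}

theorem taut (h : IsWorld i T) {A : Form ℕ} (hA : A.IsTautology) : A ∈ T :=
  h.der (.of_taut hA)

theorem bot (h : IsWorld i T) : Form.bot ∉ T :=
  h.neg.1 (h.taut fun v => by simp [Form.PropTrue])

theorem imp (h : IsWorld i T) {A B : Form ℕ} : A.imp B ∈ T ↔ (A ∈ T → B ∈ T) := by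
  refine ⟨fun h1 h2 => h.mp h2 h1, fun h1 => ?_⟩
  by_cases hA : A ∈ T
  · exact h.mp (h1 hA) (h.taut fun v => by simp only [Form.imp, Form.PropTrue]; tauto)
  · exact h.mp (h.neg.2 hA) (h.taut fun v => by simp only [Form.imp, Form.PropTrue]; tauto)

theorem and (h : IsWorld i T) {A B : Form ℕ} : A.and B ∈ T ↔ A ∈ T ∧ B ∈ T := by
  refine ⟨fun h1 => ⟨h.mp h1 (h.taut fun v => ?_), h.mp h1 (h.taut fun v => ?_)⟩, fun h1 =>
    h.mp h1.2 (h.mp h1.1 (h.taut fun v => ?_))⟩ <;>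
  · simp only [Form.imp, Form.PropTrue]; tauto

theorem or (h : IsWorld i T) {A B : Form ℕ} : A.or B ∈ T ↔ A ∈ T ∨ B ∈ T := by
  simp only [Form.or, h.neg, h.and]; tauto

theorem iff (h : IsWorld i T) {A B : Form ℕ} : A.iff B ∈ T ↔ (A ∈ T ↔ B ∈ T) := by
  simp only [Form.iff, h.imp, h.and]; tauto

theorem bigAnd (h : IsWorld i T) {l : List (Form ℕ)} :
    Form.bigAnd l ∈ T ↔ ∀ A ∈ l, A ∈ T := by
  induction l with
  | nil => simpa [Form.bigAnd, Form.top] using h.neg.2 h.bot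
  | cons A l ih => simp [Form.bigAnd, h.and, ih]

theorem cond (h : IsWorld i T) {A B : Form ℕ} {Bs : List (Form ℕ)}
    (hd : HDerivable (system i) ((Form.bigAnd Bs).imp B)) (hB : ∀ C ∈ Bs, A.cond C ∈ T) :
    A.cond B ∈ T := by
  have h1 := h.der (.rule _ (mem_system (.inr (.inl ⟨A, B, Bs, rfl⟩))) (by simpa using hd))
  exact h.imp.1 h1 (h.bigAnd.2 (by simpa using hB))

/-- `RCK` makes the set a theory, `CEM` makes it complete, and consistency is the assumption that `A
⇒ ⊥` is not in `T`. -/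
theorem successor (h : IsWorld i T) {A : Form ℕ} (hA : A.cond .bot ∉ T) :
    IsWorld i {B | A.cond B ∈ T} where
  der {B} hB := h.cond (Bs := [])
    (.mp _ _ hB (.of_taut fun v => by
      simp only [Form.imp, Form.PropTrue]; tauto)) (by simp)
  mp {B C} hB hC := h.cond (Bs := [B, B.imp C])
    (.of_taut fun v => by
      simp only [Form.imp, Form.bigAnd, Form.PropTrue]; tauto)
    (by simpa using ⟨hB, hC⟩)
  neg {B} := by
    constructor
    · intro h1 h2
      exact hA (h.cond (Bs := [B, B.neg])
        (.of_taut fun v => by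
          simp only [Form.imp, Form.bigAnd, Form.PropTrue]; tauto)
        (by simpa using ⟨h2, h1⟩))
    · intro h1
      have := h.or.1 (h.der (.rule _ (mem_system (.inr (.inr (.inr ⟨A, B, rfl⟩)))) (by simp)))
      exact this.resolve_left h1

end IsWorld

/-- Lindenbaum's lemma. -/
theorem exists_isWorld {i : Bool} {A : Form ℕ} (hA : ¬ HDerivable (system i) A) :
    ∃ T, IsWorld i T ∧ A ∉ T := by
  let 𝒮 : Set (Set (Form ℕ)) := {T | (∀ B, HDerivable (system i) B → B ∈ T) ∧
    (∀ B C, B ∈ T → B.imp C ∈ T → C ∈ T) ∧ A ∉ T}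
  obtain ⟨T, -, hT⟩ := zorn_subset_nonempty 𝒮 (by
    rintro c hc hch ⟨T₀, hT₀⟩
    refine ⟨⋃₀ c, ⟨fun B hB => ⟨T₀, hT₀, (hc hT₀).1 B hB⟩, ?_, ?_⟩,
      fun s hs => Set.subset_sUnion_of_mem hs⟩
    · rintro B C ⟨T₁, h1, hB⟩ ⟨T₂, h2, hC⟩
      rcases hch.total h1 h2 with h | h
      · exact ⟨T₂, h2, (hc h2).2.1 _ _ (h hB) hC⟩
      · exact ⟨T₁, h1, (hc h1).2.1 _ _ hB (h hC)⟩
    · rintro ⟨T₁, h1, hA1⟩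
      exact (hc h1).2.2 hA1) {B | HDerivable (system i) B}
    ⟨fun B hB => hB, fun B C hB hC => .mp B C hB hC, hA⟩
  obtain ⟨hd, hmp, hAT⟩ := hT.prop
  have taut : ∀ {B : Form ℕ}, B.IsTautology → B ∈ T := fun h => hd _ (.of_taut h)
  -- `{C | B.imp C ∈ T}` is again a theory and contains `T` and `B`; by maximality of `T` it cannot
  -- omit `A`.
  have key : ∀ B, B ∉ T → B.imp A ∈ T := by
    intro B hB
    by_contra hBA
    have hsub : T ⊆ {C | B.imp C ∈ T} := fun C hC => hmp _ _ hC (taut fun v => by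
      simp only [Form.imp, Form.PropTrue]; tauto)
    refine hB (hT.le_of_ge (y := {C | B.imp C ∈ T}) ⟨fun C hC => hsub (hd _ hC), ?_, hBA⟩ hsub
      (taut fun v => by simp only [Form.imp, Form.PropTrue]; tauto))
    intro C D hC hD
    exact hmp _ _ hD (hmp _ _ hC (taut fun v => by simp only [Form.imp, Form.PropTrue]; tauto))
  refine ⟨T, ⟨fun h => hd _ h, fun h1 h2 => hmp _ _ h1 h2, fun {B} => ⟨fun h1 h2 => ?_,
    fun h => ?_⟩⟩, hAT⟩
  · exact hAT (hmp _ _ h2 (hmp _ _ h1 (taut fun v => by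
      simp only [Form.imp, Form.PropTrue]; tauto)))
  -- If neither the formula nor its negation belongs to `T`, both imply `A` by `key`, so `A` would
  -- be in `T`.
  · by_contra h'
    exact hAT (hmp _ _ (key _ h) (hmp _ _ (key _ h') (taut fun v => by
      simp only [Form.imp, Form.PropTrue]; tauto)))

theorem derivable_iff {i : Bool} {A : Form ℕ} :
    HDerivable (system i) A ↔ ∀ T, IsWorld i T → A ∈ T := by
  refine ⟨fun h T hT => hT.der h, fun h => ?_⟩
  by_contra hA
  obtain ⟨T, hT, hAT⟩ := exists_isWorld hA
  exact hAT (h T hT)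

open Classical in
/-- The canonical model. -/
noncomputable def canon (i : Bool) : SelModel where
  W := {T : Set (Form ℕ) // IsWorld i T}
  sel T X := if h : ∃ A : Form ℕ, X = {S | A ∈ S.1} ∧ A.cond .bot ∉ T.1 then
    some ⟨_, T.2.successor h.choose_spec.2⟩ else none
  val T p := .var p ∈ T.1

/-- The formula chosen to define the proposition is immaterial: formulas with the same canonical
truth set are provably equivalent, hence interchangeable as antecedents by `RCEA`. -/
theorem canon_sel {i : Bool} (T : (canon i).W) (A : Form ℕ) :
    (A.cond .bot ∈ T.1 → (canon i).sel T {S | A ∈ S.1} = none) ∧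
    (A.cond .bot ∉ T.1 → ∃ S, (canon i).sel T {S | A ∈ S.1} = some S ∧
      ∀ B, B ∈ S.1 ↔ A.cond B ∈ T.1) := by
  have key : ∀ A' : Form ℕ, {S : (canon i).W | A ∈ S.1} = {S | A' ∈ S.1} →
      ∀ B, A.cond B ∈ T.1 ↔ A'.cond B ∈ T.1 := by
    intro A' h B
    have hd : HDerivable (system i) (A.iff A') := derivable_iff.2 fun S hS => by
      rw [hS.iff]
      exact Set.ext_iff.1 h ⟨S, hS⟩
    exact T.2.iff.1 (T.2.der (.rule _ (mem_system (.inl ⟨A, A', B, rfl⟩)) (by simpa using hd)))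
  refine ⟨fun h => dif_neg ?_, fun h => ?_⟩
  · rintro ⟨A', h1, h2⟩
    exact h2 ((key A' h1 _).1 h)
  · have h' : ∃ A' : Form ℕ, {S : (canon i).W | A ∈ S.1} = {S | A' ∈ S.1} ∧
      A'.cond .bot ∉ T.1 := ⟨A, rfl, h⟩
    exact ⟨_, dif_pos h', fun B => (key _ h'.choose_spec.1 B).symm⟩

/-- The truth lemma. By induction the truth set of an antecedent `A` is `{S | A ∈ S.1}`, which is
where `canon_sel` describes the selection. -/
theorem canon_holds {i : Bool} (A : Form ℕ) :
    ∀ T : (canon i).W, (canon i).Holds T A ↔ A ∈ T.1 := by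
  induction A with
  | bot => exact fun T => iff_of_false id T.2.bot
  | var p => exact fun T => Iff.rfl
  | neg A ih => intro T; rw [T.2.neg, ← ih T]; rfl
  | and A B ih ih' => intro T; rw [T.2.and, ← ih T, ← ih' T]; rfl
  | cond A B ih ih' =>
    intro T
    have h : {S | (canon i).Holds S A} = {S | A ∈ S.1} := Set.ext ih
    simp only [SelModel.Holds, h]
    by_cases hb : A.cond .bot ∈ T.1
    · simp only [(canon_sel T A).1 hb, reduceCtorEq, false_implies, implies_true, true_iff]
      exact T.2.cond (Bs := [.bot]) (.of_taut fun v => by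
        simp [Form.imp, Form.bigAnd, Form.PropTrue]) (by simpa using hb)
    · obtain ⟨S, hS, hB⟩ := (canon_sel T A).2 hb
      simp [hS, ih', hB]

theorem canon_identity : (canon true).Identity := by
  intro T X S h
  by_cases hA : ∃ A : Form ℕ, X = {S : (canon true).W | A ∈ S.1} ∧ A.cond .bot ∉ T.1
  · obtain ⟨A, rfl, hb⟩ := hA
    obtain ⟨S', hS', hB⟩ := (canon_sel T A).2 hb
    obtain rfl : S' = S := Option.some_inj.1 (hS'.symm.trans h)
    exact (hB A).2 (T.2.der (.rule _ (mem_system (.inr (.inr (.inl ⟨rfl, A, rfl⟩)))) (by simp)))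
  · rw [show (canon true).sel T X = none from dif_neg hA] at h
    simp at h

end CondLogic

/-! ### Loop programs and their compilation to Turing machines -/

namespace Complexity
open Turing CondLogic

/-- The work alphabet: the input symbols together with two marks. -/
inductive Tok : Type
  | sym (a : Sym) | sign (b : Bool) | aux | world
  deriving DecidableEq, Fintype

instance : Inhabited Tok := ⟨.aux⟩

/-- The inclusion of the input alphabet. -/
def Tok.ofInput : Sym ⊕ Bool → Tok
  | .inl a => .sym a
  | .inr b => .sign b

/-- Loop programs on stacks. The only loop is `rep c`, which executes `c` as often as a fixed clock
says. -/
inductive Cmd : Type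
  | skip : Cmd
  | push (r : ℕ) (a : Tok) : Cmd
  | pop (r : ℕ) (f : Option Tok → Cmd) : Cmd
  | seq (c d : Cmd) : Cmd
  | rep (c : Cmd) : Cmd

/-- The contents of the stacks. -/
abbrev Store := ℕ → List Tok

namespace Cmd

/-- The effect of a program when the clock is `n`. -/
def run (n : ℕ) : Cmd → Store → Store
  | skip => fun s => s
  | push r a => fun s => Function.update s r (a :: s r)
  | pop r f => fun s => run n (f (s r).head?) (Function.update s r (s r).tail)
  | seq c d => fun s => run n d (run n c s)
  | rep c => (run n c)^[n]

/-- A bound for the number of machine steps. -/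
def cost (n : ℕ) : Cmd → ℕ
  | skip => 0
  -- A machine step runs up to the next jump. A push needs no jump; a pop jumps to the branch for
  -- the symbol found.
  | push _ _ => 0
  | pop _ f => 1 + ∑ o, cost n (f o)
  | seq c d => cost n c + cost n d
  -- There are `n` rounds with one step each at the loop head, one step to see the clock empty, and
  -- `n + 1` steps to refill it.
  | rep c => n * (cost n c + 1) + n + 2

/-- The program is fixed, so the nesting of its loops bounds the degree. -/
theorem exists_cost_le (c : Cmd) : ∃ p : Polynomial ℕ, ∀ n, c.cost n = p.eval n := by
  induction c with
  | skip => exact ⟨0, by simp [cost]⟩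
  | push => exact ⟨0, by simp [cost]⟩
  | pop r f ih =>
    choose p hp using ih
    exact ⟨1 + ∑ o, p o, by simp [cost, hp, Polynomial.eval_finsetSum]⟩
  | seq c d ih ih' =>
    obtain ⟨p, hp⟩ := ih
    obtain ⟨q, hq⟩ := ih'
    exact ⟨p + q, by simp [cost, hp, hq]⟩
  | rep c ih =>
    obtain ⟨p, hp⟩ := ih
    exact ⟨.X * (p + 1) + .X + 2, by simp [cost, hp]⟩

/-- All stacks, and all loop nestings from depth `d` on, are numbered below `N`. -/
def Fits (N : ℕ) : ℕ → Cmd → Prop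
  | _, skip => True
  | _, push r _ => r < N
  | d, pop r f => r < N ∧ ∀ o, Fits N d (f o)
  | d, seq c c' => Fits N d c ∧ Fits N d c'
  | d, rep c => d < N ∧ Fits N (d + 1) c

theorem Fits.mono {N N' : ℕ} (h : N ≤ N') {c : Cmd} : ∀ {d}, c.Fits N d → c.Fits N' d := by
  induction c with
  | skip => exact fun _ => trivial
  | push r a => exact fun hc => lt_of_lt_of_le hc h
  | pop r f ih => exact fun hc => ⟨lt_of_lt_of_le hc.1 h, fun o => ih o (hc.2 o)⟩
  | seq c c' ih ih' => exact fun hc => ⟨ih hc.1, ih' hc.2⟩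
  | rep c ih => exact fun hc => ⟨lt_of_lt_of_le hc.1 h, ih hc.2⟩

theorem exists_fits (c : Cmd) : ∀ d, ∃ N, c.Fits N d := by
  induction c with
  | skip => exact fun _ => ⟨0, trivial⟩
  | push r a => exact fun _ => ⟨r + 1, Nat.lt_succ_self r⟩
  | pop r f ih =>
    intro d
    choose N hN using fun o => ih o d
    refine ⟨max (r + 1) (Finset.univ.sup N), lt_of_lt_of_le r.lt_succ_self (le_max_left _ _), fun o => (hN o).mono ?_⟩
    exact le_max_of_le_right (Finset.le_sup (Finset.mem_univ o))
  | seq c c' ih ih' =>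
    intro d
    obtain ⟨N, hN⟩ := ih d
    obtain ⟨N', hN'⟩ := ih' d
    exact ⟨max N N', hN.mono (le_max_left _ _), hN'.mono (le_max_right _ _)⟩
  | rep c ih =>
    intro d
    obtain ⟨N, hN⟩ := ih (d + 1)
    exact ⟨max N (d + 1), lt_of_lt_of_le d.lt_succ_self (le_max_right _ _), hN.mono (le_max_left _ _)⟩

/-- The program points that need a label. -/
@[reducible] def Lab : Cmd → Type
  | skip => Empty
  | push _ _ => Empty
  | pop _ f => Σ o, Option (Lab (f o))
  | seq c d => Lab c ⊕ Lab d
  | rep c => Option (Option (Lab c))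

instance Lab.finite (c : Cmd) : Finite c.Lab := by
  induction c with
  | skip => exact inferInstanceAs (Finite Empty)
  | push => exact inferInstanceAs (Finite Empty)
  | pop r f ih => exact inferInstanceAs (Finite (Σ o, Option (Lab (f o))))
  | seq c d ih ih' => exact inferInstanceAs (Finite (Lab c ⊕ Lab d))
  | rep c ih => exact inferInstanceAs (Finite (Option (Option (Lab c))))

end Cmd

/-- The stacks of the machine: input, output, the stacks of the program, and the clocks. -/
inductive StackIdx (N : ℕ) : Type
  | inp | out
  | reg (i : Fin N)
  | clock (p : Fin N × Bool)
  deriving DecidableEq, Fintype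

/-- The stack alphabets. -/
abbrev StackIdx.Alph {N : ℕ} : StackIdx N → Type
  | inp => Sym ⊕ Bool
  | out => Bool
  | reg _ => Tok
  | clock _ => Tok

open StackIdx

/-- Machine statements. -/
abbrev MStmt (N : ℕ) (Λ : Type) : Type := TM2.Stmt (StackIdx.Alph (N := N)) Λ (Option Tok)

/-- Machine configurations. -/
abbrev MCfg (N : ℕ) (Λ : Type) : Type := TM2.Cfg (StackIdx.Alph (N := N)) Λ (Option Tok)

/-- The machine `M` leads from one configuration to another one in `t` steps. -/
def StepsTo {N : ℕ} {Λ : Type} (M : Λ → MStmt N Λ) (t : ℕ) (a b : MCfg N Λ) : Prop :=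
  (flip bind (TM2.step M))^[t] (some a) = some b

namespace StepsTo

variable {N : ℕ} {Λ : Type} {M : Λ → MStmt N Λ} {a b c : MCfg N Λ}

theorem refl : StepsTo M 0 a a := rfl

theorem trans {t u : ℕ} (h : StepsTo M t a b) (h' : StepsTo M u b c) : StepsTo M (t + u) a c := by
  unfold StepsTo at *
  rw [add_comm, Function.iterate_add_apply, h, h']

theorem step {t : ℕ} {l : Λ} {v : Option Tok} {S : ∀ k : StackIdx N, List k.Alph}
    (h : StepsTo M t (TM2.stepAux (M l) v S) b) : StepsTo M (t + 1) ⟨some l, v, S⟩ b := h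

end StepsTo

/-- The machine stacks with given contents. -/
def contents {N : ℕ} (I : List (Sym ⊕ Bool)) (O : List Bool) (s : Store)
    (C : Fin N × Bool → List Tok) : ∀ k : StackIdx N, List k.Alph
  | inp => I
  | out => O
  | reg i => s i
  | clock p => C p

section contents

variable {N : ℕ} {Λ : Type} {I : List (Sym ⊕ Bool)} {O : List Bool} {s : Store}
  {C : Fin N × Bool → List Tok} {v : Option Tok} {q : MStmt N Λ}

theorem update_contents_inp (l : List (Sym ⊕ Bool)) :
    Function.update (contents I O s C) inp l = contents l O s C := by
  funext k
  cases k <;> rfl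

theorem update_contents_out (l : List Bool) :
    Function.update (contents I O s C) out l = contents I l s C := by
  funext k
  cases k <;> rfl

theorem update_contents_reg (i : Fin N) (l : List Tok) :
    Function.update (contents I O s C) (reg i) l = contents I O (Function.update s i l) C := by
  funext k
  cases k with
  | reg j =>
    by_cases h : j = i
    · subst h
      rw [Function.update_self]
      exact (Function.update_self (β := fun _ => List Tok) (j : ℕ) l s).symm
    · rw [Function.update_of_ne (by simpa using h)]
      exact (Function.update_of_ne (fun h' => h (Fin.ext h')) l s).symm
  | _ => rfl

theorem update_contents_clock (p : Fin N × Bool) (l : List Tok) :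
    Function.update (contents I O s C) (clock p) l = contents I O s (Function.update C p l) := by
  funext k
  cases k with
  | clock j =>
    by_cases h : j = p
    · subst h
      rw [Function.update_self]
      exact (Function.update_self (β := fun _ => List Tok) j l C).symm
    · rw [Function.update_of_ne (by simpa using h)]
      exact (Function.update_of_ne h l C).symm
  | _ => rfl

theorem stepAux_push_reg {r : ℕ} (hr : r < N) (f : Option Tok → Tok) :
    TM2.stepAux (.push (reg ⟨r, hr⟩) f q) v (contents I O s C) =
      TM2.stepAux q v (contents I O (Function.update s r (f v :: s r)) C) := by
  rw [TM2.stepAux, update_contents_reg]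
  rfl

theorem stepAux_pop_reg {r : ℕ} (hr : r < N) :
    TM2.stepAux (.pop (reg ⟨r, hr⟩) (fun _ o => o) q) v (contents I O s C) =
      TM2.stepAux q (s r).head? (contents I O (Function.update s r (s r).tail) C) := by
  rw [TM2.stepAux, update_contents_reg]
  rfl

theorem stepAux_push_clock {p : Fin N × Bool} (f : Option Tok → Tok) :
    TM2.stepAux (.push (clock p) f q) v (contents I O s C) =
      TM2.stepAux q v (contents I O s (Function.update C p (f v :: C p))) := by
  rw [TM2.stepAux, update_contents_clock]
  rfl

theorem stepAux_pop_clock {p : Fin N × Bool} :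
    TM2.stepAux (.pop (clock p) (fun _ o => o) q) v (contents I O s C) =
      TM2.stepAux q (C p).head? (contents I O s (Function.update C p (C p).tail)) := by
  rw [TM2.stepAux, update_contents_clock]
  rfl

end contents

/-- The clocks from depth `d` on are loaded with `n`. -/
def Loaded {N : ℕ} (n d : ℕ) (C : Fin N × Bool → List Tok) : Prop :=
  ∀ j : Fin N, d ≤ j → C (j, true) = List.replicate n default ∧ C (j, false) = []

namespace Cmd

variable {N : ℕ} {Λ : Type}

/-- Machine code of a program at loop depth `d`, followed by `k`. -/
def code (N : ℕ) : ℕ → (c : Cmd) → (c.Lab → Λ) → MStmt N Λ → MStmt N Λ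
  | _, skip, _, k => k
  | _, push r a, _, k => if h : r < N then .push (reg ⟨r, h⟩) (fun _ => a) k else k
  | _, pop r _, e, k =>
    if h : r < N then .pop (reg ⟨r, h⟩) (fun _ o => o) (.goto fun v => e ⟨v, none⟩) else k
  | d, seq c c', e, k => code N d c (e ∘ .inl) (code N d c' (e ∘ .inr) k)
  | _, rep _, e, _ => .goto fun _ => e none

/-- The statements at the labels of a program. -/
def body (N : ℕ) : ℕ → (c : Cmd) → (c.Lab → Λ) → MStmt N Λ → c.Lab → MStmt N Λ
  | d, pop _ f, e, k, ⟨o, none⟩ => code N d (f o) (fun l => e ⟨o, some l⟩) k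
  | d, pop _ f, e, k, ⟨o, some l⟩ => body N d (f o) (fun l => e ⟨o, some l⟩) k l
  | d, seq c c', e, k, .inl l => body N d c (e ∘ .inl) (code N d c' (e ∘ .inr) k) l
  | d, seq _ c', e, k, .inr l => body N d c' (e ∘ .inr) k l
  | d, rep c, e, k, none =>
    if h : d < N then
      .pop (clock (⟨d, h⟩, true)) (fun _ o => o) (.branch Option.isSome
        (.push (clock (⟨d, h⟩, false)) (fun _ => (default : Tok))
          (code N (d + 1) c (fun l => e (some (some l))) (.goto fun _ => e none)))
        (.goto fun _ => e (some none)))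
    else k
  | d, rep _, e, k, some none =>
    if h : d < N then
      .pop (clock (⟨d, h⟩, false)) (fun _ o => o) (.branch Option.isSome
        (.push (clock (⟨d, h⟩, true)) (fun _ => (default : Tok)) (.goto fun _ => e (some none))) k)
    else k
  | d, rep c, e, _, some (some l) =>
    body N (d + 1) c (fun l => e (some (some l))) (.goto fun _ => e none) l

/-- Every nesting depth has its own clock, a pair of stacks. A loop pours the first into the second
while it counts and then pours it back, so the clocks are full again when the loop is next entered;
this is why `C` is the same before and after. -/
theorem code_correct (M : Λ → MStmt N Λ) (n : ℕ) (I : List (Sym ⊕ Bool)) (O : List Bool) (c : Cmd) :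
    ∀ (d : ℕ) (e : c.Lab → Λ) (k : MStmt N Λ), c.Fits N d → (∀ l, M (e l) = body N d c e k l) →
    ∀ (s : Store) (C : Fin N × Bool → List Tok) (v : Option Tok), Loaded n d C →
    ∃ t ≤ c.cost n, ∃ v', StepsTo M t (TM2.stepAux (code N d c e k) v (contents I O s C))
      (TM2.stepAux k v' (contents I O (c.run n s) C)) := by
  induction c with
  | skip => exact fun d e k _ _ s C v _ => ⟨0, le_rfl, v, .refl⟩
  | push r a =>
    intro d e k hf _ s C v _
    have hr : r < N := hf
    refine ⟨0, le_rfl, v, ?_⟩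
    rw [code, dif_pos hr, stepAux_push_reg]
    exact .refl
  | pop r f ih =>
    intro d e k hf hM s C v hL
    obtain ⟨hr, hf⟩ := hf
    obtain ⟨t, ht, v', h1⟩ := ih (s r).head? d (fun l => e ⟨_, some l⟩) k (hf _)
      (fun l => hM ⟨_, some l⟩) (Function.update s r (s r).tail) C (s r).head? hL
    refine ⟨t + 1, ?_, v', ?_⟩
    · have := Finset.single_le_sum (f := fun o => cost n (f o)) (fun _ _ => Nat.zero_le _)
        (Finset.mem_univ (s r).head?)
      simp only [cost]
      omega
    · have h0 : M (e ⟨(s r).head?, none⟩) = _ := hM ⟨(s r).head?, none⟩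
      rw [code, dif_pos hr, stepAux_pop_reg]
      refine StepsTo.step ?_
      rw [h0]
      exact h1
  | seq c c' ih ih' =>
    intro d e k hf hM s C v hL
    obtain ⟨t, ht, v', h1⟩ := ih d (e ∘ .inl) (code N d c' (e ∘ .inr) k) hf.1
      (fun l => hM (.inl l)) s C v hL
    obtain ⟨t', ht', v'', h1'⟩ := ih' d (e ∘ .inr) k hf.2
      (fun l => hM (.inr l)) (c.run n s) C v' hL
    exact ⟨t + t', add_le_add ht ht', v'', h1.trans h1'⟩
  | rep c ih =>
    intro d e k hf hM s C v hL
    obtain ⟨hd, hf⟩ := hf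
    have h0 : M (e none) = _ := hM none
    have h0' : M (e (some none)) = _ := hM (some none)
    simp only [body, dif_pos hd] at h0 h0'
    -- Pouring back: `b` symbols are still on the second stack of the clock.
    have restore : ∀ (b a : ℕ) (v : Option Tok) (s : Store) (C : Fin N × Bool → List Tok),
        C (⟨d, hd⟩, true) = List.replicate a default → C (⟨d, hd⟩, false) = List.replicate b default →
        ∃ v', StepsTo M (b + 1) ⟨some (e (some none)), v, contents I O s C⟩ (TM2.stepAux k v'
          (contents I O s (Function.update (Function.update C (⟨d, hd⟩, false) []) (⟨d, hd⟩, true)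
            (List.replicate (a + b) default)))) := by
      intro b
      induction b with
      | zero =>
        intro a v s C h1 h2
        have hC : Function.update (Function.update C (⟨d, hd⟩, false) []) (⟨d, hd⟩, true)
            (C (⟨d, hd⟩, true)) = Function.update C (⟨d, hd⟩, false) [] :=
          Function.update_eq_self_iff.2 (by simp)
        refine ⟨none, StepsTo.step ?_⟩
        rw [h0', stepAux_pop_clock, h2, add_zero, ← h1, List.replicate_zero, List.tail_nil, hC]
        exact .refl
      | succ b ihb =>
        intro a v s C h1 h2
        obtain ⟨v', h⟩ := ihb (a + 1) (some default) s
          (Function.update (Function.update C (⟨d, hd⟩, false) (List.replicate b default))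
            (⟨d, hd⟩, true) (List.replicate (a + 1) default)) (by simp) (by simp)
        refine ⟨v', StepsTo.step ?_⟩
        rw [h0', stepAux_pop_clock, h2, List.replicate_succ, List.tail_cons, List.head?_cons,
          TM2.stepAux, Option.isSome_some, cond_true, stepAux_push_clock,
          Function.update_of_ne (by simp), h1, ← List.replicate_succ]
        have hC : Function.update (Function.update (Function.update (Function.update C
            (⟨d, hd⟩, false) (List.replicate b default)) (⟨d, hd⟩, true)
            (List.replicate (a + 1) default)) (⟨d, hd⟩, false) []) (⟨d, hd⟩, true)
            (List.replicate (a + 1 + b) default) = Function.update (Function.update C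
            (⟨d, hd⟩, false) []) (⟨d, hd⟩, true) (List.replicate (a + (b + 1)) default) := by
          have hne : ((⟨d, hd⟩, true) : Fin N × Bool) ≠ (⟨d, hd⟩, false) := by simp
          rw [Function.update_comm (β := fun _ => List Tok) hne (List.replicate (a + 1) default) [],
            Function.update_idem, Function.update_idem, show a + (b + 1) = a + 1 + b by omega]
        rw [hC] at h
        exact h
    -- Counting: `a` rounds remain and `b` are done; `a + b` is what the clock holds afterwards.
    have loop : ∀ (a b : ℕ) (s : Store) (v : Option Tok) (C : Fin N × Bool → List Tok),
        Loaded n (d + 1) C → C (⟨d, hd⟩, true) = List.replicate a default →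
        C (⟨d, hd⟩, false) = List.replicate b default →
        ∃ t ≤ a * (cost n c + 1) + (a + b) + 2, ∃ v',
        StepsTo M t ⟨some (e none), v, contents I O s C⟩ (TM2.stepAux k v' (contents I O ((c.run n)^[a] s)
          (Function.update (Function.update C (⟨d, hd⟩, false) []) (⟨d, hd⟩, true)
            (List.replicate (a + b) default)))) := by
      intro a
      induction a with
      | zero =>
        intro b s v C hL h1 h2
        obtain ⟨v', h⟩ := restore b 0 none s C h1 h2
        refine ⟨b + 1 + 1, by omega, v', StepsTo.step ?_⟩
        rw [h0, stepAux_pop_clock, h1, List.replicate_zero, List.tail_nil,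
          Function.update_eq_self_iff.2 (by simp [h1])]
        exact h
      | succ a iha =>
        intro b s v C hL h1 h2
        set C₁ := Function.update (Function.update C (⟨d, hd⟩, true)
          (List.replicate a default)) (⟨d, hd⟩, false) (List.replicate (b + 1) default) with hC1
        have hL1 : Loaded n (d + 1) C₁ := by
          intro j hj
          have hne : j ≠ ⟨d, hd⟩ := by rintro rfl; simp at hj
          simpa [hC1, hne] using hL j hj
        obtain ⟨t, ht, v', h3⟩ := ih (d + 1) (fun l => e (some (some l)))
          (.goto fun _ => e none) hf (fun l => hM (some (some l))) s C₁ (some default) hL1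
        obtain ⟨t', ht', v'', h3'⟩ := iha (b + 1) (c.run n s) v' C₁ hL1
          (by simp [hC1]) (by simp [hC1])
        refine ⟨t + t' + 1, ?_, v'', StepsTo.step ?_⟩
        · have : (a + 1) * (cost n c + 1) = a * (cost n c + 1) + cost n c + 1 := by ring
          omega
        · rw [h0, stepAux_pop_clock, h1, List.replicate_succ, List.tail_cons, List.head?_cons,
            TM2.stepAux, Option.isSome_some, cond_true, stepAux_push_clock,
            Function.update_of_ne (by simp), h2, ← List.replicate_succ]
          refine h3.trans ?_
          have hC : Function.update (Function.update C₁ (⟨d, hd⟩, false) []) (⟨d, hd⟩, true)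
              (List.replicate (a + (b + 1)) default) = Function.update (Function.update C
              (⟨d, hd⟩, false) []) (⟨d, hd⟩, true) (List.replicate (a + 1 + b) default) := by
            rw [hC1, Function.update_idem, Function.update_comm (by simp), Function.update_idem,
              Function.update_comm (by simp), show a + 1 + b = a + (b + 1) by omega]
          rw [hC] at h3'
          exact h3'
    obtain ⟨h1, h2⟩ := hL ⟨d, hd⟩ le_rfl
    obtain ⟨t, ht, v', h3⟩ := loop n 0 s v C (fun j hj => hL j (by omega)) h1 h2
    refine ⟨t, ht, v', ?_⟩
    have hC : Function.update C (⟨d, hd⟩, false) [] = C := Function.update_eq_self_iff.2 h2.symm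
    rw [hC, add_zero, ← h1, Function.update_eq_self] at h3
    exact h3

/-- Push a symbol on all the given clocks. -/
def pushClocks (l : List (Fin N)) (q : MStmt N Λ) : MStmt N Λ :=
  l.foldr (fun j q => .push (clock (j, true)) (fun _ => (default : Tok)) q) q

/-- Pop a symbol from all the given clocks. -/
def popClocks (l : List (Fin N)) (q : MStmt N Λ) : MStmt N Λ :=
  l.foldr (fun j q => .pop (clock (j, true)) (fun v _ => v) q) q

/-- The clocks with value `n`. -/
def clocks (N n : ℕ) (p : Fin N × Bool) : List Tok :=
  if p.2 then List.replicate n default else []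

section clocks

variable {I : List (Sym ⊕ Bool)} {O : List Bool} {s : Store} {v : Option Tok} {q : MStmt N Λ}

theorem stepAux_pushClocks {l : List (Fin N)} (hl : l.Nodup) :
    ∀ C : Fin N × Bool → List Tok, TM2.stepAux (pushClocks l q) v (contents I O s C) =
      TM2.stepAux q v (contents I O s fun p => if p.2 = true ∧ p.1 ∈ l then default :: C p else C p) := by
  induction l with
  | nil => intro C; simp [pushClocks]
  | cons j l ih =>
    intro C
    rw [List.nodup_cons] at hl
    change TM2.stepAux (.push (clock (j, true)) (fun _ => default) (pushClocks l q)) _ _ = _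
    rw [stepAux_push_clock, ih hl.2]
    congr 2
    funext p
    obtain ⟨i, b⟩ := p
    by_cases hi : i = j
    · subst hi
      cases b <;> simp [hl.1]
    · simp [hi]

theorem stepAux_popClocks {l : List (Fin N)} (hl : l.Nodup) :
    ∀ C : Fin N × Bool → List Tok, TM2.stepAux (popClocks l q) v (contents I O s C) =
      TM2.stepAux q v (contents I O s fun p => if p.2 = true ∧ p.1 ∈ l then (C p).tail else C p) := by
  induction l with
  | nil => intro C; simp [popClocks]
  | cons j l ih =>
    intro C
    rw [List.nodup_cons] at hl
    change TM2.stepAux (.pop (clock (j, true)) (fun v _ => v) (popClocks l q)) _ _ = _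
    rw [TM2.stepAux, update_contents_clock, ih hl.2]
    congr 2
    funext p
    obtain ⟨i, b⟩ := p
    by_cases hi : i = j
    · subst hi
      cases b <;> simp [hl.1, contents]
    · simp [hi]

theorem stepAux_pushClocks_finRange (n : ℕ) :
    TM2.stepAux (pushClocks (List.finRange N) q) v (contents I O s (clocks N n)) =
      TM2.stepAux q v (contents I O s (clocks N (n + 1))) := by
  rw [stepAux_pushClocks (List.nodup_finRange N)]
  congr 2
  funext p
  obtain ⟨i, b⟩ := p
  cases b <;> simp [clocks, List.replicate_succ]

theorem stepAux_popClocks_finRange (n : ℕ) :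
    TM2.stepAux (popClocks (List.finRange N) q) v (contents I O s (clocks N (n + 1))) =
      TM2.stepAux q v (contents I O s (clocks N n)) := by
  rw [stepAux_popClocks (List.nodup_finRange N)]
  congr 2
  funext p
  obtain ⟨i, b⟩ := p
  cases b <;> simp [clocks, List.replicate_succ]

end clocks

section machine

variable (N : ℕ) (c : Cmd) (z r : Fin N)

/-- The final part of the machine program: write the output. -/
def post : MStmt N (Fin 3 ⊕ c.Lab) :=
  .pop (reg r) (fun _ o => o) (.push out Option.isSome (.goto fun _ => .inl 2))

/-- The machine that loads its input on the stack `z`, runs `c`, and outputs whether the stack `r`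
is nonempty. -/
def machine : Fin 3 ⊕ c.Lab → MStmt N (Fin 3 ⊕ c.Lab)
  | .inl 0 => pushClocks (List.finRange N) (.goto fun _ => .inl 1)
  | .inl 1 => .pop inp (fun _ o => o.map Tok.ofInput) (.branch Option.isSome
      (.push (reg z) (fun v => (v.getD default : Tok))
        (pushClocks (List.finRange N) (.goto fun _ => .inl 1)))
      (code N 0 c .inr (post N c r)))
  | .inl 2 => .peek (clock (z, true)) (fun _ o => o) (.branch Option.isSome
      (popClocks (List.finRange N) (.goto fun _ => .inl 2)) .halt)
  | .inr l => body N 0 c .inr (post N c r) l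

/-- Each input symbol read also adds a symbol to every clock, so the clocks measure the input. The
input arrives in reverse order. -/
theorem machine_load (I : List (Sym ⊕ Bool)) : ∀ (l : List Tok) (n : ℕ) (v : Option Tok), ∃ v',
    StepsTo (machine N c z r) I.length
      ⟨some (.inl 1), v, contents I [] (Function.update (fun _ => []) z l) (clocks N n)⟩
      ⟨some (.inl 1), v', contents [] [] (Function.update (fun _ => []) z
        ((I.map Tok.ofInput).reverse ++ l)) (clocks N (n + I.length))⟩ := by
  induction I with
  | nil => exact fun l n v => ⟨v, .refl⟩
  | cons a I ih =>
    intro l n v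
    obtain ⟨v', h⟩ := ih (Tok.ofInput a :: l) (n + 1) (some (Tok.ofInput a))
    refine ⟨v', StepsTo.step ?_⟩
    rw [machine, TM2.stepAux, update_contents_inp]
    change StepsTo _ _ (TM2.stepAux (.push (reg ⟨z, z.2⟩) (fun v => (v.getD default : Tok))
      (pushClocks (List.finRange N) (.goto fun _ => Sum.inl 1))) (some (Tok.ofInput a))
      (contents I [] _ _)) _
    rw [stepAux_push_reg, stepAux_pushClocks_finRange]
    simp only [Function.update_idem, Function.update_self, Option.getD_some]
    simp only [List.map_cons, List.reverse_cons, List.append_assoc, List.cons_append,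
      List.nil_append, List.length_cons]
    rw [show n + (I.length + 1) = n + 1 + I.length by omega]
    exact h

/-- A halting configuration must have every stack except the output empty, so the clocks are emptied
at the end. -/
theorem machine_clean (O : List Bool) : ∀ (n : ℕ) (v : Option Tok),
    StepsTo (machine N c z r) (n + 1)
      ⟨some (.inl 2), v, contents [] O (fun _ => []) (clocks N n)⟩
      ⟨none, none, contents [] O (fun _ => []) (clocks N 0)⟩ := by
  intro n
  induction n with
  | zero => exact fun v => StepsTo.step .refl
  | succ n ih =>
    intro v
    refine StepsTo.step ?_
    rw [machine, TM2.stepAux]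
    change StepsTo _ _ (TM2.stepAux (popClocks _ _) (some default) _) _
    rw [stepAux_popClocks_finRange]
    exact ih _

theorem machine_correct (hc : c.Fits N 0) (I : List (Sym ⊕ Bool)) (o : List Tok)
    (h : c.run (I.length + 1) (Function.update (fun _ => []) (z : ℕ) (I.map Tok.ofInput).reverse) =
      Function.update (fun _ => []) (r : ℕ) o) (ho : o.length ≤ 1) :
    ∃ t ≤ c.cost (I.length + 1) + 2 * I.length + 4, StepsTo (machine N c z r) t
      ⟨some (.inl 0), none, contents I [] (fun _ => []) (clocks N 0)⟩
      ⟨none, none, contents [] [o.head?.isSome] (fun _ => []) (clocks N 0)⟩ := by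
  obtain ⟨v, h1⟩ := machine_load N c z r I [] 1 none
  obtain ⟨t, ht, v', h2⟩ := code_correct (machine N c z r) (I.length + 1) [] [] c 0 .inr
    (post N c r) hc (fun l => rfl) (Function.update (fun _ => []) z (I.map Tok.ofInput).reverse)
    (clocks N (I.length + 1)) none (fun j _ => by simp [clocks])
  have h3 := machine_clean N c z r [o.head?.isSome] (I.length + 1) o.head?
  -- One step gives the clocks their initial symbol, `I.length` steps load the input, one sees its
  -- end, `t` run the program, and the rest clears the clocks.
  refine ⟨1 + (I.length + (1 + (t + (I.length + 1 + 1)))), by omega, ?_⟩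
  refine StepsTo.trans (b := ⟨some (.inl 1), none, contents I [] (fun _ => []) (clocks N 1)⟩)
    (StepsTo.step (t := 0) ?_) ?_
  · rw [machine, stepAux_pushClocks_finRange]
    exact .refl
  have hz : (fun _ => [] : Store) = Function.update (fun _ => []) (z : ℕ) [] := by
    rw [Function.update_eq_self_iff.2 rfl]
  rw [List.append_nil, ← hz, add_comm 1] at h1
  refine h1.trans (StepsTo.trans (StepsTo.step (t := 0) ?_) (h2.trans ?_))
  · rw [machine, TM2.stepAux, update_contents_inp]
    exact .refl
  rw [h]
  have h4 : TM2.stepAux (post N c r) v' (contents [] [] (Function.update (fun _ => []) r o)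
      (clocks N (I.length + 1))) = ⟨some (.inl 2), o.head?,
        contents [] [o.head?.isSome] (fun _ => []) (clocks N (I.length + 1))⟩ := by
    change TM2.stepAux (.pop (reg ⟨r, r.2⟩) _ _) _ _ = _
    rw [stepAux_pop_reg, Function.update_idem, Function.update_self, TM2.stepAux,
      update_contents_out, TM2.stepAux]
    congr 2
    -- One pop empties the result stack because it holds at most one symbol.
    rw [Function.update_eq_self_iff]
    cases o with
    | nil => rfl
    | cons a o => simpa using ho
  rw [h4]
  exact h3

/-- The machine as a bundled Turing machine. -/
noncomputable def turingMachine : FinTM2 :=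
  letI : Fintype c.Lab := Fintype.ofFinite _
  { K := StackIdx N
    k₀ := inp
    k₁ := out
    Γ := StackIdx.Alph
    Λ := Fin 3 ⊕ c.Lab
    main := .inl 0
    σ := Option Tok
    initialState := none
    Γk₀Fin := inferInstanceAs (Fintype (Sym ⊕ Bool))
    m := machine N c z r }

end machine

/-- A loop program that decides a verifier yields a polynomial time Turing machine. -/
theorem polyTime (c : Cmd) (r : ℕ) (V : List Sym × List Bool → Bool)
    (h : ∀ x w, c.run (x.length + w.length + 1) (Function.update (fun _ => []) 0
      ((x.map Sum.inl ++ w.map Sum.inr).map Tok.ofInput).reverse) =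
        Function.update (fun _ => []) r (if V (x, w) then [default] else [])) :
    Nonempty (TM2ComputableInPolyTime
      (Computability.encodingProd (Computability.encodingList Sym)
        (Computability.encodingList Bool)).encode Computability.encodeBool V) := by
  obtain ⟨N, hN⟩ := c.exists_fits 0
  obtain ⟨p, hp⟩ := c.exists_cost_le
  have hN' := hN.mono (le_max_left N (r + 1))
  have hr : r < max N (r + 1) := lt_of_lt_of_le r.lt_succ_self (le_max_right _ _)
  generalize max N (r + 1) = N at hN' hr
  refine ⟨⟨⟨turingMachine N c ⟨0, by omega⟩ ⟨r, hr⟩, Equiv.refl _, Equiv.refl _⟩,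
    p.comp (.X + 1) + 2 * .X + 4, ?_⟩⟩
  rintro ⟨x, w⟩
  have hl : (x.map Sum.inl ++ w.map Sum.inr : List (Sym ⊕ Bool)).length = x.length + w.length := by
    simp
  have hm := machine_correct N c ⟨0, by omega⟩ ⟨r, hr⟩ hN' (x.map Sum.inl ++ w.map Sum.inr)
    (if V (x, w) then [default] else []) (by rw [hl]; exact h x w) (by split_ifs <;> simp)
  choose t ht hm using hm
  have h1 : initList (turingMachine N c ⟨0, by omega⟩ ⟨r, hr⟩)
      (x.map Sum.inl ++ w.map Sum.inr : List (Sym ⊕ Bool)) =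
      ⟨some (.inl 0), none, contents (x.map Sum.inl ++ w.map Sum.inr) [] (fun _ => [])
        (clocks N 0)⟩ := by
    unfold initList
    congr 1
    funext k
    rcases k with _ | _ | i | ⟨i, b⟩
    iterate 3 · rfl
    cases b <;> rfl
  have h2 : haltList (turingMachine N c ⟨0, by omega⟩ ⟨r, hr⟩) [V (x, w)] =
      ⟨none, none, contents [] [V (x, w)] (fun _ => []) (clocks N 0)⟩ := by
    unfold haltList
    congr 1
    funext k
    rcases k with _ | _ | i | ⟨i, b⟩
    iterate 3 · rfl
    cases b <;> rfl
  have h3 : (if V (x, w) = true then [default] else [] : List Tok).head?.isSome = V (x, w) := by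
    cases V (x, w) <;> rfl
  rw [h3] at hm
  have h4 : (x.map Sum.inl ++ w.map Sum.inr : List (Sym ⊕ Bool)).map (Equiv.refl _).invFun =
    x.map Sum.inl ++ w.map Sum.inr := List.map_id _
  change TM2OutputsInTime (turingMachine N c ⟨0, by omega⟩ ⟨r, hr⟩)
    ((x.map Sum.inl ++ w.map Sum.inr : List (Sym ⊕ Bool)).map (Equiv.refl _).invFun)
    (some [V (x, w)])
    (Polynomial.eval (x.map Sum.inl ++ w.map Sum.inr : List (Sym ⊕ Bool)).length _)
  refine ⟨⟨t, ?_⟩, ?_⟩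
  · refine (congrArg (fun s => (flip bind _)^[t] (some s))
      ((congrArg (initList _) h4).trans h1)).trans (Eq.trans hm ?_)
    exact congrArg some h2.symm
  · simpa [hp] using ht

end Cmd
end Complexity

/-! ### A calculus of string functions computed by loop programs -/

namespace Complexity
open Turing CondLogic

namespace Cmd

/-- Move the contents of stack `a` to stack `b`, in reverse order. -/
def move (a b : ℕ) : Cmd := rep (pop a fun o => o.elim skip (push b))

/-- Empty a stack. -/
def clear (a : ℕ) : Cmd := rep (pop a fun _ => skip)

/-- Popping an empty stack does nothing, so surplus rounds of the loop are idle. All later loops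
rely on the same principle: the body becomes the identity once the work is done. -/
theorem run_move {a b n : ℕ} (hab : a ≠ b) {s : Store} (hs : (s a).length ≤ n) :
    (move a b).run n s = Function.update (Function.update s b ((s a).reverse ++ s b)) a [] := by
  suffices h : ∀ (k : ℕ) (s : Store), (s a).length ≤ k →
      ((pop a fun o => o.elim skip (push b)).run n)^[k] s =
        Function.update (Function.update s b ((s a).reverse ++ s b)) a [] from h n s hs
  intro k
  induction k with
  | zero =>
    intro s hs
    have h0 : s a = [] := by simpa using hs
    rw [h0, List.reverse_nil, List.nil_append, Function.update_eq_self,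
      Function.update_eq_self_iff.2 h0.symm]
    rfl
  | succ k ih =>
    intro s hs
    rw [Function.iterate_succ_apply]
    cases h : s a with
    | nil =>
      have h1 : (pop a fun o => o.elim skip (push b)).run n s = s := by
        simp only [run, h, List.head?_nil, List.tail_nil, Option.elim]
        exact Function.update_eq_self_iff.2 h.symm
      rw [h1, ih s (by simp [h]), h]
    | cons x l =>
      have h1 : (pop a fun o => o.elim skip (push b)).run n s =
          Function.update (Function.update s a l) b (x :: s b) := by
        simp [run, h, hab.symm]
      rw [h1, ih _ (by simp [h, hab] at hs ⊢; omega)]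
      funext i
      by_cases hi : i = a
      · subst hi; simp
      · by_cases hb : i = b
        · subst hb; simp [hi, hab]
        · simp [hi, hb]

theorem run_clear {a n : ℕ} {s : Store} (hs : (s a).length ≤ n) :
    (clear a).run n s = Function.update s a [] := by
  suffices h : ∀ (k : ℕ) (s : Store), (s a).length ≤ k →
      ((pop a fun _ => skip).run n)^[k] s = Function.update s a [] from h n s hs
  intro k
  induction k with
  | zero =>
    intro s hs
    have h0 : s a = [] := by simpa using hs
    simp [← h0]
  | succ k ih =>
    intro s hs
    rw [Function.iterate_succ_apply, ih]
    · simp [run]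
    · simp [run]; omega

/-- Copy stack `r` to the empty stack `m`, using the empty stack `m + 1`. -/
def copy (r m : ℕ) : Cmd :=
  seq (move r (m + 1)) (rep (pop (m + 1) fun o => o.elim skip fun x => seq (push r x) (push m x)))

/-- The contents go to the auxiliary stack and come back to both stacks; the two reversals cancel.
-/
theorem run_copy {r m n : ℕ} (hr : r < m) {s : Store} (hs : (s r).length ≤ n) (hm : s m = [])
    (hm' : s (m + 1) = []) : (copy r m).run n s = Function.update s m (s r) := by
  suffices h : ∀ (k : ℕ) (s : Store), (s (m + 1)).length ≤ k →
      ((pop (m + 1) fun o => o.elim skip fun x => seq (push r x) (push m x)).run n)^[k] s =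
        Function.update (Function.update (Function.update s r ((s (m + 1)).reverse ++ s r)) m
          ((s (m + 1)).reverse ++ s m)) (m + 1) [] by
    have hne : r ≠ m + 1 := by omega
    change ((pop (m + 1) _).run n)^[n] ((move r (m + 1)).run n s) = _
    rw [run_move hne hs, h]
    · funext i
      by_cases h1 : i = m + 1
      · subst h1; simp [hm']
      · by_cases h2 : i = m
        · subst h2; simp [hne.symm, hm', hm, hr.ne']
        · by_cases h3 : i = r
          · subst h3; simp [h2, hne, hne.symm, hm']
          · simp [h1, h2, h3]
    · simpa [hne.symm, hm'] using hs
  intro k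
  induction k with
  | zero =>
    intro s hs
    have h0 : s (m + 1) = [] := by simpa using hs
    rw [h0, List.reverse_nil, List.nil_append, List.nil_append, Function.update_eq_self,
      Function.update_eq_self, Function.update_eq_self_iff.2 h0.symm]
    rfl
  | succ k ih =>
    intro s hs
    rw [Function.iterate_succ_apply]
    have hne : r ≠ m + 1 := by omega
    cases h : s (m + 1) with
    | nil =>
      have h1 : (pop (m + 1) fun o => o.elim skip fun x => seq (push r x) (push m x)).run n s = s := by
        simp only [run, h, List.head?_nil, List.tail_nil, Option.elim]
        exact Function.update_eq_self_iff.2 h.symm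
      rw [h1, ih s (by simp [h]), h]
    | cons x l =>
      have h0 : (pop (m + 1) fun o => o.elim skip fun x => seq (push r x) (push m x)).run n s =
          Function.update (Function.update (Function.update s (m + 1) l) r (x :: s r)) m (x :: s m) := by
        simp [run, h, hne, hr.ne']
      rw [h0, ih _ (by simp [h, hne.symm] at hs ⊢; omega)]
      funext i
      by_cases h1 : i = m + 1
      · subst h1; simp
      · by_cases h2 : i = m
        · subst h2; simp [hne.symm]
        · by_cases h3 : i = r
          · subst h3; simp [h1, h2, hne.symm]
          · simp [h1, h2, h3]

end Cmd

/-- Types of tuples of strings. -/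
class Ctx (E : Type) where
  vars : List (E → List Tok)

instance : Ctx (List Tok) := ⟨[id]⟩

instance {E : Type} [Ctx E] : Ctx (E × List Tok) := ⟨Prod.snd :: Ctx.vars.map fun v e => v e.1⟩

/-- `f` is computed by a loop program that leaves its inputs unchanged, whatever stacks the inputs
are on. The inputs and the output are at most as long as the clock. -/
def Prog {E : Type} [Ctx E] (f : E → List Tok) : Prop :=
  ∀ (ρ : List ℕ) (m : ℕ), (∀ r ∈ ρ, r < m) → ∃ c : Cmd, ∀ (n : ℕ) (e : E) (s : Store), 1 ≤ n →
    ρ.map s = Ctx.vars.map (fun v => v e) → (∀ i, m ≤ i → s i = []) →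
    (∀ r ∈ ρ, (s r).length ≤ n) → c.run n s = Function.update s m (f e) ∧ (f e).length ≤ n

open Classical in
/-- `P` is decided by a loop program. -/
def ProgPred {E : Type} [Ctx E] (P : E → Prop) : Prop :=
  Prog fun e => if P e then [default] else []

open Classical in
/-- The first suffix that satisfies `P`, and the empty suffix if there is none. -/
noncomputable def findSuffix (P : List Tok → Prop) : List Tok → List Tok
  | [] => []
  | a :: l => if P (a :: l) then a :: l else findSuffix P l

/-- Reduces a quantifier over suffixes to a search followed by one test. A failed search ends at the
empty suffix, for which the test also fails. -/
theorem findSuffix_spec (P : List Tok → Prop) (l : List Tok) :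
    P (findSuffix P l) ↔ ∃ t, t <:+ l ∧ P t := by
  induction l with
  | nil => simp [findSuffix]
  | cons a l ih =>
    rw [findSuffix]
    split_ifs with h
    · exact iff_of_true h ⟨_, List.suffix_rfl, h⟩
    · rw [ih]
      simp only [List.suffix_cons_iff]
      constructor
      · rintro ⟨t, h1, h2⟩
        exact ⟨t, .inr h1, h2⟩
      · rintro ⟨t, rfl | h1, h2⟩
        · exact (h h2).elim
        · exact ⟨t, h1, h2⟩

theorem length_findSuffix_le (P : List Tok → Prop) (l : List Tok) :
    (findSuffix P l).length ≤ l.length := by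
  induction l with
  | nil => simp [findSuffix]
  | cons a l ih =>
    rw [findSuffix]
    split_ifs
    · rfl
    · simp; omega

/-- What remains of the first list when the longest common prefix is removed. -/
def rem : List Tok → List Tok → List Tok
  | [], _ => []
  | a :: l, [] => a :: l
  | a :: l, b :: l' => if a = b then rem l l' else a :: l

/-- Through `rem`, prefixes, equality and concatenation are tested without building a string longer
than the given ones, which the length bound in `Prog` requires. -/
theorem rem_eq_nil {l l' : List Tok} : rem l l' = [] ↔ l <+: l' := by
  induction l generalizing l' with
  | nil => simp [rem]
  | cons a l ih =>
    cases l' with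
    | nil => simp [rem]
    | cons b l' =>
      rw [rem, List.cons_prefix_cons]
      split_ifs with h
      · simp [h, ih]
      · simp [h]

theorem rem_append (l t : List Tok) : rem (l ++ t) l = t := by
  induction l with
  | nil => cases t <;> rfl
  | cons a l ih => simpa [rem] using ih

theorem length_rem_le (l l' : List Tok) : (rem l l').length ≤ l.length := by
  induction l generalizing l' with
  | nil => simp [rem]
  | cons a l ih =>
    cases l' with
    | nil => simp [rem]
    | cons b l' =>
      rw [rem]
      split_ifs
      · have := ih l'; simp; omega
      · rfl

theorem update_swap {m : ℕ} (u : Store) (x y : List Tok) :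
    Function.update (Function.update u (m + 1) x) m y =
      Function.update (Function.update u m y) (m + 1) x :=
  Function.update_comm (by omega) _ _ _

namespace Prog

variable {E : Type} [Ctx E] {f g : E → List Tok}

theorem snd : Prog fun e : E × List Tok => e.2 := by
  rintro ρ m hρ
  cases ρ with
  | nil => exact ⟨.skip, fun n e s _ h => by simp [Ctx.vars] at h⟩
  | cons r ρ =>
    refine ⟨.copy r m, fun n e s _ h hs hl => ?_⟩
    have h1 : s r = e.2 := by
      simp only [Ctx.vars, List.map_cons, List.cons.injEq] at h
      exact h.1
    have h2 := hl r (by simp)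
    exact ⟨by rw [Cmd.run_copy (hρ r (by simp)) h2 (hs m le_rfl) (hs _ (Nat.le_succ m)), h1],
      by simpa only [h1] using h2⟩

theorem self : Prog fun e : List Tok => e := by
  rintro ρ m hρ
  cases ρ with
  | nil => exact ⟨.skip, fun n e s _ h => by simp [Ctx.vars] at h⟩
  | cons r ρ =>
    refine ⟨.copy r m, fun n e s _ h hs hl => ?_⟩
    have h1 : s r = e := by
      simp only [Ctx.vars, List.map_cons, List.cons.injEq] at h
      exact h.1
    have h2 := hl r (by simp)
    exact ⟨by rw [Cmd.run_copy (hρ r (by simp)) h2 (hs m le_rfl) (hs _ (Nat.le_succ m)), h1],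
      by simpa only [h1] using h2⟩

/-- Weakening: the newest variable stands first in a context and is ignored. -/
theorem lift (hf : Prog f) : Prog fun e : E × List Tok => f e.1 := by
  rintro ρ m hρ
  cases ρ with
  | nil => exact ⟨.skip, fun n e s _ h => by simp [Ctx.vars] at h⟩
  | cons r ρ =>
    obtain ⟨c, hc⟩ := hf ρ m fun r' hr => hρ r' (by simp [hr])
    refine ⟨c, fun n e s hn h hs hl => hc n e.1 s hn ?_ hs fun r' hr => hl r' (by simp [hr])⟩
    simp only [Ctx.vars, List.map_cons, List.cons.injEq, List.map_map] at h
    rw [h.2]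
    rfl

theorem update_mem {ρ : List ℕ} {m : ℕ} (hρ : ∀ r ∈ ρ, r < m) {s : Store} {l : List Tok} :
    ρ.map (Function.update s m l) = ρ.map s :=
  List.map_congr_left fun r hr => Function.update_of_ne (hρ r hr).ne _ _

/-- Extending the context by a computed string. -/
theorem bind {g : E × List Tok → List Tok} (hf : Prog f) (hg : Prog g) :
    Prog fun e => g (e, f e) := by
  intro ρ m hρ
  obtain ⟨c, hc⟩ := hf ρ m hρ
  have hρ' : ∀ r ∈ m :: ρ, r < m + 1 := by
    intro r hr
    rcases List.mem_cons.1 hr with rfl | hr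
    · exact Nat.lt_succ_self _
    · exact (hρ r hr).trans (Nat.lt_succ_self _)
  obtain ⟨d, hd⟩ := hg (m :: ρ) (m + 1) hρ'
  -- The result has to end on stack `m`; moving it twice restores its order.
  refine ⟨.seq c (.seq d (.seq (.clear m) (.seq (.move (m + 1) (m + 2)) (.move (m + 2) m)))),
    fun n e s hn h hs hl => ?_⟩
  obtain ⟨h1, h2⟩ := hc n e s hn h hs hl
  obtain ⟨h3, h4⟩ := hd n (e, f e) (Function.update s m (f e)) hn
    (by simp only [List.map_cons, Function.update_self, update_mem hρ, h, Ctx.vars, List.map_map]; rfl)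
    (fun i hi => by rw [Function.update_of_ne (by omega), hs i (by omega)])
    (fun r hr => by
      rcases List.mem_cons.1 hr with rfl | hr
      · simpa using h2
      · rw [Function.update_of_ne (hρ r hr).ne]; exact hl r hr)
  refine ⟨?_, h4⟩
  simp only [Cmd.run, h1, h3]
  rw [Cmd.run_clear (by simpa using h2), Cmd.run_move (a := m + 1) (by omega) (by simpa using h4),
    Cmd.run_move (by omega) (by simpa [hs] using h4)]
  funext i
  by_cases hi : i = m
  · subst hi; simp [hs]
  · by_cases hi1 : i = m + 1
    · subst hi1; simp [hs]
    · by_cases hi2 : i = m + 2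
      · subst hi2; simp [hs]
      · simp [hi, hi1, hi2]

theorem tail (hf : Prog f) : Prog fun e => (f e).tail := by
  intro ρ m hρ
  obtain ⟨c, hc⟩ := hf ρ m hρ
  refine ⟨.seq c (.pop m fun _ => .skip), fun n e s hn h hs hl => ?_⟩
  obtain ⟨h1, h2⟩ := hc n e s hn h hs hl
  exact ⟨by simp [Cmd.run, h1], by simp; omega⟩

/-- Case distinction on the first symbol. -/
theorem cases {g : Option Tok → E → List Tok} (hf : Prog f) (hg : ∀ o, Prog (g o)) :
    Prog fun e => g (f e).head? e := by
  intro ρ m hρ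
  obtain ⟨c, hc⟩ := hf ρ m hρ
  choose d hd using fun o => hg o ρ m hρ
  refine ⟨.seq c (.pop m fun o => .seq (.clear m) (d o)), fun n e s hn h hs hl => ?_⟩
  obtain ⟨h1, h2⟩ := hc n e s hn h hs hl
  obtain ⟨h3, h4⟩ := hd (f e).head? n e s hn h hs hl
  refine ⟨?_, h4⟩
  simp only [Cmd.run, h1, Function.update_self, Function.update_idem]
  rw [Cmd.run_clear (by simp; omega), Function.update_idem,
    Function.update_eq_self_iff.2 (hs m le_rfl).symm, h3]

theorem nil : Prog fun _ : E => [] := fun _ m _ =>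
  ⟨.skip, fun n e s _ _ hs _ => ⟨(Function.update_eq_self_iff.2 (hs m le_rfl).symm).symm, by simp⟩⟩

theorem single (a : Tok) : Prog fun _ : E => [a] := fun _ m _ =>
  ⟨.push m a, fun n e s hn _ hs _ => ⟨by simp [Cmd.run, hs], hn⟩⟩

theorem findSuffix {P : E → List Tok → Prop} (hf : Prog f)
    (hP : ProgPred fun p : E × List Tok => P p.1 p.2) : Prog fun e => findSuffix (P e) (f e) := by
  intro ρ m hρ
  obtain ⟨c, hc⟩ := hf ρ m hρ
  have hρ' : ∀ r ∈ m :: ρ, r < m + 1 := by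
    intro r hr
    rcases List.mem_cons.1 hr with rfl | hr
    · exact Nat.lt_succ_self _
    · exact (hρ r hr).trans (Nat.lt_succ_self _)
  obtain ⟨d, hd⟩ := hP (m :: ρ) (m + 1) hρ'
  -- Each round tests the current suffix and drops a symbol if the test fails. After the first
  -- success nothing changes any more.
  refine ⟨.seq c (.rep (.seq d (.pop (m + 1) fun o => o.elim (.pop m fun _ => .skip) fun _ => .skip))),
    fun n e s hn h hs hl => ?_⟩
  obtain ⟨h1, h2⟩ := hc n e s hn h hs hl
  refine ⟨?_, (length_findSuffix_le _ _).trans h2⟩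
  set b := Cmd.seq d (.pop (m + 1) fun o => o.elim (.pop m fun _ => .skip) fun _ => .skip) with hb
  have step : ∀ l : List Tok, l.length ≤ n → (P e l → b.run n (Function.update s m l) =
      Function.update s m l) ∧ (¬ P e l → b.run n (Function.update s m l) =
        Function.update s m l.tail) := by
    intro l hln
    obtain ⟨h3, -⟩ := hd n (e, l) (Function.update s m l) hn
      (by simp only [List.map_cons, Function.update_self, update_mem hρ, h, Ctx.vars, List.map_map]
          rfl)
      (fun i hi => by rw [Function.update_of_ne (by omega), hs i (by omega)])
      (fun r hr => by
        rcases List.mem_cons.1 hr with rfl | hr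
        · simpa using hln
        · rw [Function.update_of_ne (hρ r hr).ne]; exact hl r hr)
    have h4 : ∀ l : List Tok, Function.update (Function.update s m l) (m + 1) [] =
        Function.update s m l := fun l =>
      Function.update_eq_self_iff.2 (by simp [hs])
    constructor <;> intro hP <;> simp only [hb, Cmd.run, h3, hP, if_true, if_false] <;>
      simp [Cmd.run, h4]
  have loop : ∀ (k : ℕ) (l : List Tok), l.length ≤ n → l.length ≤ k →
      (b.run n)^[k] (Function.update s m l) = Function.update s m (Complexity.findSuffix (P e) l) := by
    intro k
    induction k with
    | zero =>
      intro l _ hk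
      obtain rfl : l = [] := by simpa using hk
      rfl
    | succ k ih =>
      intro l hln hk
      rw [Function.iterate_succ_apply]
      by_cases hPl : P e l
      · have hfix : ∀ k, (b.run n)^[k] (Function.update s m l) = Function.update s m l := fun k =>
          Function.iterate_fixed ((step l hln).1 hPl) k
        rw [(step l hln).1 hPl, hfix]
        cases l with
        | nil => rfl
        | cons a l => rw [Complexity.findSuffix, if_pos hPl]
      · rw [(step l hln).2 hPl, ih _ (by simp; omega) (by simp; omega)]
        cases l with
        | nil => rfl
        | cons a l => rw [Complexity.findSuffix, if_neg hPl]; rfl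
  have : (Cmd.rep b).run n = (b.run n)^[n] := rfl
  simp only [Cmd.run, h1]
  exact loop n _ h2 h2

theorem takeWhile (p : Tok → Bool) (hf : Prog f) : Prog fun e => (f e).takeWhile p := by
  intro ρ m hρ
  obtain ⟨c, hc⟩ := hf ρ m hρ
  -- The first symbol that violates `p` empties the source, so the remaining rounds are idle.
  set b := Cmd.pop m fun o => o.elim .skip fun a =>
    if p a then .push (m + 1) a else .clear m with hb
  refine ⟨.seq c (.seq (.rep b) (.move (m + 1) m)), fun n e s hn h hs hl => ?_⟩
  obtain ⟨h1, h2⟩ := hc n e s hn h hs hl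
  have h3 := (List.takeWhile_prefix p (l := f e)).length_le
  refine ⟨?_, h3.trans h2⟩
  have loop : ∀ (k : ℕ) (l acc : List Tok), l.length ≤ n → l.length ≤ k →
      (b.run n)^[k] (Function.update (Function.update s m l) (m + 1) acc) =
        Function.update (Function.update s m []) (m + 1) ((l.takeWhile p).reverse ++ acc) := by
    intro k
    induction k with
    | zero =>
      intro l acc _ hk
      obtain rfl : l = [] := by simpa using hk
      rfl
    | succ k ih =>
      intro l acc hln hk
      rw [Function.iterate_succ_apply]
      cases l with
      | nil =>
        have h5 : b.run n (Function.update (Function.update s m []) (m + 1) acc) =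
            Function.update (Function.update s m []) (m + 1) acc := by
          simp [hb, Cmd.run, update_swap]
        rw [h5, ih [] acc (by simp) (by simp)]
      | cons a l =>
        simp only [List.length_cons] at hln hk
        by_cases ha : p a
        · have h5 : b.run n (Function.update (Function.update s m (a :: l)) (m + 1) acc) =
              Function.update (Function.update s m l) (m + 1) (a :: acc) := by
            simp [hb, Cmd.run, ha, update_swap]
          rw [h5, ih l _ (by omega) (by omega), List.takeWhile_cons_of_pos ha, List.reverse_cons,
            List.append_assoc, List.singleton_append]
        · have h5 : b.run n (Function.update (Function.update s m (a :: l)) (m + 1) acc) =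
              Function.update (Function.update s m []) (m + 1) acc := by
            simp only [hb, Cmd.run, ne_eq, Nat.left_eq_add, one_ne_zero, not_false_eq_true,
              Function.update_of_ne, Function.update_self, List.head?_cons, Option.elim, ha,
              List.tail_cons, update_swap, Function.update_idem, if_false, Bool.false_eq_true]
            rw [Cmd.run_clear (by simp; omega), update_swap, Function.update_idem]
          rw [h5, ih [] acc (by simp) (by simp), List.takeWhile_cons_of_neg ha, List.takeWhile_nil]
  have h4 : Function.update s m (f e) =
      Function.update (Function.update s m (f e)) (m + 1) [] :=
    (Function.update_eq_self_iff.2 (by simp [hs])).symm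
  simp only [Cmd.run, h1]
  rw [h4, loop n _ _ h2 h2, Cmd.run_move (by omega) (by simp; omega)]
  funext i
  by_cases hi : i = m
  · subst hi; simp
  · by_cases hi1 : i = m + 1
    · subst hi1; simp [hs]
    · simp [hi, hi1]

theorem rem (hf : Prog f) (hg : Prog g) : Prog fun e => rem (f e) (g e) := by
  intro ρ m hρ
  obtain ⟨c, hc⟩ := hf ρ m hρ
  obtain ⟨d, hd⟩ := hg ρ (m + 1) fun r hr => (hρ r hr).trans (Nat.lt_succ_self _)
  -- On a mismatch, or when the second string is exhausted, what was popped is pushed back, so the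
  -- state is a fixed point.
  set b := Cmd.pop m fun o => o.elim .skip fun x => .pop (m + 1) fun o' => o'.elim (.push m x)
    fun y => if x = y then .skip else .seq (.push (m + 1) y) (.push m x) with hb
  refine ⟨.seq c (.seq d (.seq (.rep b) (.clear (m + 1)))), fun n e s hn h hs hl => ?_⟩
  obtain ⟨h1, h2⟩ := hc n e s hn h hs hl
  obtain ⟨h3, h4⟩ := hd n e (Function.update s m (f e)) hn
    (by rw [update_mem hρ, h])
    (fun i hi => by rw [Function.update_of_ne (by omega), hs i (by omega)])
    (fun r hr => by rw [Function.update_of_ne (hρ r hr).ne]; exact hl r hr)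
  refine ⟨?_, (length_rem_le _ _).trans h2⟩
  -- The rest `l''` of the second string is irrelevant, as it is cleared; only its length must not
  -- exceed the clock.
  have loop : ∀ (k : ℕ) (l l' : List Tok), l.length ≤ k → ∃ l'', l''.length ≤ l'.length ∧
      (b.run n)^[k] (Function.update (Function.update s m l) (m + 1) l') =
        Function.update (Function.update s m (Complexity.rem l l')) (m + 1) l'' := by
    intro k
    induction k with
    | zero =>
      intro l l' hk
      obtain rfl : l = [] := by simpa using hk
      exact ⟨l', le_rfl, rfl⟩
    | succ k ih =>
      intro l l' hk
      have hfix : ∀ l l', b.run n (Function.update (Function.update s m l) (m + 1) l') =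
          (Function.update (Function.update s m l) (m + 1) l') →
          (b.run n)^[k + 1] (Function.update (Function.update s m l) (m + 1) l') =
          (Function.update (Function.update s m l) (m + 1) l') :=
        fun l l' h => Function.iterate_fixed h _
      cases l with
      | nil =>
        refine ⟨l', le_rfl, hfix _ _ ?_⟩
        simp [hb, Cmd.run, update_swap]
      | cons x l =>
        cases l' with
        | nil =>
          refine ⟨[], le_rfl, hfix _ _ ?_⟩
          simp [hb, Cmd.run, update_swap]
        | cons y l' =>
          by_cases hxy : x = y
          · obtain ⟨l'', h5, h6⟩ := ih l l' (by simpa using hk)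
            refine ⟨l'', h5.trans (by simp), ?_⟩
            rw [Complexity.rem, if_pos hxy, ← h6, Function.iterate_succ_apply]
            congr 1
            simp [hb, Cmd.run, update_swap, hxy]
          · refine ⟨y :: l', le_rfl, ?_⟩
            rw [Complexity.rem, if_neg hxy]
            refine hfix _ _ ?_
            simp [hb, Cmd.run, update_swap, hxy]
  obtain ⟨l'', h5, h6⟩ := loop n (f e) (g e) h2
  simp only [Cmd.run, h1, h3]
  rw [h6, Cmd.run_clear (by simp; omega), Function.update_idem]
  exact Function.update_eq_self_iff.2 (by simp [hs])

end Prog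
end Complexity

/-! ### Predicates decided by loop programs, and the decoding of certificates -/

namespace Complexity
open Turing CondLogic

theorem Prog.congr {E : Type} [Ctx E] {f g : E → List Tok} (hf : Prog f) (h : ∀ e, g e = f e) :
    Prog g :=
  (funext h : g = f) ▸ hf

namespace ProgPred

variable {E : Type} [Ctx E] {f g h : E → List Tok} {P Q : E → Prop}

theorem congr (hP : ProgPred P) (h : ∀ e, Q e ↔ P e) : ProgPred Q :=
  (funext fun e => propext (h e) : Q = P) ▸ hP

open Classical in
theorem ite (hP : ProgPred P) (hf : Prog f) (hg : Prog g) :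
    Prog fun e => if P e then f e else g e := by
  have := Prog.cases (g := fun o e => o.elim (g e) fun _ => f e) hP
    (fun o => by cases o <;> assumption)
  refine this.congr fun e => ?_
  by_cases h : P e <;> simp [h]

theorem const (p : Prop) : ProgPred fun _ : E => p := by
  unfold ProgPred
  by_cases h : p
  · simpa [h] using Prog.single _
  · simpa [h] using Prog.nil

theorem not (hP : ProgPred P) : ProgPred fun e => ¬ P e := by
  refine Prog.congr (hP.ite Prog.nil (Prog.single default)) fun e => ?_
  by_cases h : P e <;> simp [h]

theorem and (hP : ProgPred P) (hQ : ProgPred Q) : ProgPred fun e => P e ∧ Q e := by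
  refine Prog.congr (hP.ite hQ Prog.nil) fun e => ?_
  by_cases h : P e <;> by_cases h' : Q e <;> simp [h, h']

theorem or (hP : ProgPred P) (hQ : ProgPred Q) : ProgPred fun e => P e ∨ Q e := by
  refine Prog.congr (hP.ite (Prog.single default) hQ) fun e => ?_
  by_cases h : P e <;> by_cases h' : Q e <;> simp [h, h']

theorem imp (hP : ProgPred P) (hQ : ProgPred Q) : ProgPred fun e => P e → Q e :=
  (hP.not.or hQ).congr fun _ => imp_iff_not_or

theorem bind {P : E × List Tok → Prop} (hf : Prog f) (hP : ProgPred P) :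
    ProgPred fun e => P (e, f e) := Prog.bind hf hP

/-- Bounded quantification costs one more loop nesting, so formulas with any fixed number of such
quantifiers stay decidable. -/
theorem exists_suffix {P : E → List Tok → Prop} (hf : Prog f)
    (hP : ProgPred fun p : E × List Tok => P p.1 p.2) :
    ProgPred fun e => ∃ t, t <:+ f e ∧ P e t :=
  (bind (hf.findSuffix hP) hP).congr fun e => (findSuffix_spec (P e) (f e)).symm

theorem forall_suffix {P : E → List Tok → Prop} (hf : Prog f)
    (hP : ProgPred fun p : E × List Tok => P p.1 p.2) :
    ProgPred fun e => ∀ t, t <:+ f e → P e t :=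
  (exists_suffix (P := fun e t => ¬ P e t) hf hP.not).not.congr fun e => by push Not; rfl

theorem head (p : Option Tok → Prop) (hf : Prog f) : ProgPred fun e => p (f e).head? :=
  Prog.cases hf fun o => const (p o)

theorem prefix_of (hf : Prog f) (hg : Prog g) : ProgPred fun e => f e <+: g e :=
  (head (· = none) (hf.rem hg)).congr fun e => by rw [List.head?_eq_none_iff, rem_eq_nil]

theorem eq (hf : Prog f) (hg : Prog g) : ProgPred fun e => f e = g e :=
  ((prefix_of hf hg).and (prefix_of hg hf)).congr fun e =>
    ⟨fun h => by rw [h]; exact ⟨List.prefix_rfl, List.prefix_rfl⟩,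
      fun h => h.1.eq_of_length (le_antisymm h.1.length_le h.2.length_le)⟩

/-- The concatenation is never formed: `g e` is removed from the front of `f e` and the rest is
compared with `h e`. -/
theorem eq_append (hf : Prog f) (hg : Prog g) (hh : Prog h) : ProgPred fun e => f e = g e ++ h e :=
  ((prefix_of hg hf).and (eq (hf.rem hg) hh)).congr fun e =>
    ⟨fun h => by rw [h]; exact ⟨List.prefix_append _ _, rem_append _ _⟩,
      fun h => by obtain ⟨⟨t, ht⟩, h⟩ := h; rw [← ht, rem_append] at h; rw [← ht, h]⟩

end ProgPred

/-- Block code for the work alphabet. -/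
def Tok.ofBits : Bool → Bool → Bool → Bool → Tok
  | false, false, false, b => .sign b
  | false, false, true, false => .aux
  | false, false, true, true => .world
  | false, true, false, b => .sym (.bit b)
  | false, true, true, false => .sym .bot
  | false, true, true, true => .sym .var
  | true, false, false, false => .sym .neg
  | true, false, false, true => .sym .and
  | true, false, true, false => .sym .cond
  | true, false, true, true => .sym .endMark
  | true, true, _, _ => .aux

/-- The string that a bit string codes. -/
def decode : List Bool → List Tok
  | a :: b :: c :: d :: w => Tok.ofBits a b c d :: decode w
  | _ => []

theorem Tok.exists_ofBits (t : Tok) : ∃ a b c d, Tok.ofBits a b c d = t := by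
  rcases t with (_ | _ | _ | _ | _ | b | _) | b | _ | _
  exacts [⟨false, true, true, false, rfl⟩, ⟨false, true, true, true, rfl⟩,
    ⟨true, false, false, false, rfl⟩, ⟨true, false, false, true, rfl⟩, ⟨true, false, true, false, rfl⟩,
    ⟨false, true, false, b, rfl⟩, ⟨true, false, true, true, rfl⟩, ⟨false, false, false, b, rfl⟩,
    ⟨false, false, true, false, rfl⟩, ⟨false, false, true, true, rfl⟩]

theorem exists_decode (c : List Tok) : ∃ w, decode w = c ∧ w.length = 4 * c.length := by
  induction c with
  | nil => exact ⟨[], rfl, rfl⟩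
  | cons t c ih =>
    obtain ⟨w, h1, h2⟩ := ih
    obtain ⟨a, b, b', d, h⟩ := t.exists_ofBits
    exact ⟨a :: b :: b' :: d :: w, by rw [decode, h, h1], by simp [h2]; omega⟩

theorem length_decode_le : ∀ w, (decode w).length ≤ w.length
  | a :: b :: c :: d :: w => by
    have := length_decode_le w
    simp [decode]; omega
  | [] => by simp [decode]
  | [_] => by simp [decode]
  | [_, _] => by simp [decode]
  | [_, _, _] => by simp [decode]

namespace Cmd

/-- The store with given contents of the stacks `0`, `1`, `2`, `3`. -/
def store (a b c d : List Tok) : Store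
  | 0 => a
  | 1 => b
  | 2 => c
  | 3 => d
  | _ => []

section store

variable {a b c d l : List Tok}

theorem update_store_zero : Function.update (store a b c d) 0 l = store l b c d := by
  funext i
  rcases i with _ | _ | _ | _ | i <;> rfl

theorem update_store_one : Function.update (store a b c d) 1 l = store a l c d := by
  funext i
  rcases i with _ | _ | _ | _ | i <;> rfl

theorem update_store_two : Function.update (store a b c d) 2 l = store a b l d := by
  funext i
  rcases i with _ | _ | _ | _ | i <;> rfl

theorem update_store_three : Function.update (store a b c d) 3 l = store a b c l := by
  funext i
  rcases i with _ | _ | _ | _ | i <;> rfl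

end store

/-- The stack for an input symbol. -/
def target : Tok → ℕ
  | .sign _ => 2
  | _ => 1

/-- Distribute the input to two stacks. -/
def splitStep : Cmd := pop 0 fun o => o.elim skip fun t => push (target t) t

theorem iterate_splitStep_nil (n k : ℕ) (u v : List Tok) :
    (splitStep.run n)^[k] (store [] u v []) = store [] u v [] :=
  Function.iterate_fixed (by simp [splitStep, run, store, update_store_zero]) k

theorem iterate_splitStep_sym (n : ℕ) (x : List Sym) : ∀ (k : ℕ) (u v : List Tok), x.length ≤ k →
    (splitStep.run n)^[k] (store (x.map Tok.sym) u v []) =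
      store [] ((x.map Tok.sym).reverse ++ u) v [] := by
  induction x with
  | nil => exact fun k u v _ => iterate_splitStep_nil n k u v
  | cons a x ih =>
    intro k u v hk
    obtain ⟨k, rfl⟩ : ∃ j, k = j + 1 := ⟨k - 1, by simp at hk; omega⟩
    rw [Function.iterate_succ_apply]
    convert ih k (.sym a :: u) v (by simpa using hk) using 2
    · simp [splitStep, target, run, store, update_store_zero, update_store_one]
    · simp

theorem iterate_splitStep (n : ℕ) (w : List Bool) (x : List Sym) :
    ∀ (k : ℕ) (u v : List Tok), w.length + x.length ≤ k →
    (splitStep.run n)^[k] (store (w.map Tok.sign ++ x.map Tok.sym) u v []) =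
      store [] ((x.map Tok.sym).reverse ++ u) ((w.map Tok.sign).reverse ++ v) [] := by
  induction w with
  | nil =>
    intro k u v hk
    simpa using iterate_splitStep_sym n x k u v (by simpa using hk)
  | cons a w ih =>
    intro k u v hk
    obtain ⟨k, rfl⟩ : ∃ j, k = j + 1 := ⟨k - 1, by simp at hk; omega⟩
    rw [Function.iterate_succ_apply]
    convert ih k u (.sign a :: v) (by simp at hk; omega) using 2
    · simp [splitStep, target, run, store, update_store_zero, update_store_two]
    · simp

/-- The input lies reversed on stack `0`, certificate bits on top; distributing it reverses both
parts once more and so restores their order. -/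
theorem run_split {n : ℕ} (x : List Sym) (w : List Bool) (h : x.length + w.length ≤ n) :
    (rep splitStep).run n
      (store ((x.map Sum.inl ++ w.map Sum.inr).map Tok.ofInput).reverse [] [] []) =
      store [] (x.map Tok.sym) (w.map Tok.sign) [] := by
  have := iterate_splitStep n w.reverse x.reverse n [] [] (by simpa [add_comm] using h)
  simp only [List.map_reverse, List.reverse_reverse, List.append_nil] at this
  rw [← this]
  simp only [run, List.map_append, List.map_map, List.reverse_append]
  rfl

/-- The block of four symbols. -/
def block : Option Tok → Option Tok → Option Tok → Option Tok → Cmd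
  | some (.sign a), some (.sign b), some (.sign c), some (.sign d) => push 3 (Tok.ofBits a b c d)
  | _, _, _, _ => skip

/-- Decode the next block of stack `2` to stack `3`. -/
def decodeStep : Cmd := pop 2 fun a => pop 2 fun b => pop 2 fun c => pop 2 fun d => block a b c d

theorem run_decode {n : ℕ} (w : List Bool) (h : w.length ≤ n) (x : List Tok) :
    (rep decodeStep).run n (store [] x (w.map Tok.sign) []) = store [] x [] (decode w).reverse := by
  suffices H : ∀ (k : ℕ) (w : List Bool) (v : List Tok), w.length ≤ k →
      (decodeStep.run n)^[k] (store [] x (w.map Tok.sign) v) =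
          store [] x [] ((decode w).reverse ++ v) by
    have := H n w [] h
    rwa [List.append_nil] at this
  intro k
  induction k with
  | zero =>
    intro w v hw
    obtain rfl : w = [] := by simpa using hw
    rfl
  | succ k ih =>
    intro w v hw
    rw [Function.iterate_succ_apply]
    -- An incomplete block at the end of the bit string is popped and ignored, in accordance with
    -- `decode`.
    have hnil := ih [] v (by simp)
    rcases w with _ | ⟨a, _ | ⟨b, _ | ⟨c, _ | ⟨d, w⟩⟩⟩⟩
    · simpa [decodeStep, block, run, store, update_store_two, decode] using hnil
    · simpa [decodeStep, block, run, store, update_store_two, decode] using hnil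
    · simpa [decodeStep, block, run, store, update_store_two, decode] using hnil
    · simpa [decodeStep, block, run, store, update_store_two, decode] using hnil
    · have := ih w (Tok.ofBits a b c d :: v) (by simp at hw; omega)
      simpa [decodeStep, block, run, store, update_store_two, update_store_three, decode] using this

end Cmd

open Classical in
/-- Predicates of the input and the decoded certificate that are decided by loop programs are
computable in polynomial time. -/
theorem ProgPred.polyTime {P : List Tok → List Tok → Prop}
    (hP : ProgPred fun p : List Tok × List Tok => P p.1 p.2) :
    Nonempty (TM2ComputableInPolyTime
      (Computability.encodingProd (Computability.encodingList Sym)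
        (Computability.encodingList Bool)).encode Computability.encodeBool
        fun q => decide (P (q.1.map Tok.sym) (decode q.2))) := by
  -- Contexts list the last component first: the certificate is on stack `2`, the input on `1`, and
  -- the verdict appears on `3`. Stacks `1` and `2` are cleared because only the verdict may remain.
  obtain ⟨c, hc⟩ := hP [2, 1] 3 (by simp)
  refine Cmd.polyTime (.seq (.rep .splitStep) (.seq (.rep .decodeStep) (.seq (.move 3 2) (.seq c
    (.seq (.clear 1) (.clear 2)))))) 3 _ fun x w => ?_
  set n := x.length + w.length + 1 with hn
  have hw := length_decode_le w
  have h0 : Function.update (fun _ => []) 0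
      ((x.map Sum.inl ++ w.map Sum.inr).map Tok.ofInput).reverse =
      Cmd.store ((x.map Sum.inl ++ w.map Sum.inr).map Tok.ofInput).reverse [] [] [] := by
    funext i
    rcases i with _ | _ | _ | _ | i <;> rfl
  obtain ⟨h1, -⟩ := hc n (x.map Tok.sym, decode w) (Cmd.store [] (x.map Tok.sym) (decode w) [])
    (by omega) rfl
    (by
      intro i hi
      obtain ⟨i, rfl⟩ := Nat.exists_eq_add_of_le' hi
      cases i <;> rfl)
    (by
      simp only [List.mem_cons, List.not_mem_nil, or_false, forall_eq_or_imp, forall_eq, Cmd.store,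
        List.length_map]
      omega)
  rw [h0]
  change ((Cmd.clear 2).run n ((Cmd.clear 1).run n (c.run n ((Cmd.move 3 2).run n
    ((Cmd.rep .decodeStep).run n ((Cmd.rep .splitStep).run n _)))))) = _
  rw [Cmd.run_split x w (by omega), Cmd.run_decode w (by omega),
    Cmd.run_move (by omega) (by simp [Cmd.store]; omega)]
  simp only [Cmd.store, List.reverse_reverse, List.append_nil, Cmd.update_store_two,
    Cmd.update_store_three]
  rw [h1, Cmd.update_store_three, Cmd.run_clear (a := 1) (by simp [Cmd.store]; omega), Cmd.update_store_one,
    Cmd.run_clear (a := 2) (by simp [Cmd.store]; omega), Cmd.update_store_two]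
  simp only [decide_eq_true_eq]
  funext i
  rcases i with _ | _ | _ | _ | i <;> rfl

end Complexity

/-! ### The format of certificates and the verifier -/

namespace Complexity
open Turing CondLogic

/-- Weakening below the newest variable. A quantifier over entries binds a suffix and then the entry
cut from it, and the matrix must not see the suffix. -/
theorem Prog.drop {E : Type} [Ctx E] {f : E × List Tok → List Tok} (hf : Prog f) :
    Prog fun q : (E × List Tok) × List Tok => f (q.1.1, q.2) := by
  rintro ρ m hρ
  rcases ρ with _ | ⟨r, _ | ⟨r', ρ⟩⟩
  · exact ⟨.skip, fun n e s _ h => by simp [Ctx.vars] at h⟩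
  · exact ⟨.skip, fun n e s _ h => by simp [Ctx.vars] at h⟩
  · have hsub : ∀ i ∈ r :: ρ, i ∈ r :: r' :: ρ := by
      intro i hi
      simp only [List.mem_cons] at hi ⊢
      tauto
    obtain ⟨c, hc⟩ := hf (r :: ρ) m fun i hi => hρ i (hsub i hi)
    refine ⟨c, fun n e s hn h hs hl => hc n (e.1.1, e.2) s hn ?_ hs fun i hi => hl i (hsub i hi)⟩
    simp only [Ctx.vars, List.map_cons, List.cons.injEq, List.map_map] at h ⊢
    exact ⟨h.1, h.2.2⟩

/-- An entry of a list: what follows a mark, up to the first symbol that does not satisfy `q`. -/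
def Entry (p : Option Tok → Prop) (q : Tok → Bool) (l s : List Tok) : Prop :=
  ∃ t, t <:+ l ∧ p t.head? ∧ t.tail.takeWhile q = s

namespace ProgPred

variable {E : Type} [Ctx E] {f g : E → List Tok} {p : Option Tok → Prop} {q : Tok → Bool}
  {P : E → List Tok → Prop}

theorem exists_entry (hf : Prog f) (hP : ProgPred fun p : E × List Tok => P p.1 p.2) :
    ProgPred fun e => ∃ s, Entry p q (f e) s ∧ P e s := by
  have hP' : ProgPred fun r : (E × List Tok) × List Tok => P r.1.1 r.2 := Prog.drop hP
  refine (exists_suffix (P := fun e t => p t.head? ∧ P e (t.tail.takeWhile q)) hf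
    ((head p Prog.snd).and (bind (Prog.snd.tail.takeWhile q) hP'))).congr fun e => ?_
  constructor
  · rintro ⟨s, ⟨t, h1, h2, rfl⟩, h3⟩
    exact ⟨t, h1, h2, h3⟩
  · rintro ⟨t, h1, h2, h3⟩
    exact ⟨_, ⟨t, h1, h2, rfl⟩, h3⟩

theorem forall_entry (hf : Prog f) (hP : ProgPred fun p : E × List Tok => P p.1 p.2) :
    ProgPred fun e => ∀ s, Entry p q (f e) s → P e s :=
  (exists_entry (P := fun e t => ¬ P e t) hf hP.not).not.congr fun e => by push Not; rfl

theorem entry (hf : Prog f) (hg : Prog g) : ProgPred fun e => Entry p q (f e) (g e) :=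
  (exists_entry (P := fun e t => t = g e) (p := p) (q := q) hf (eq Prog.snd hg.lift)).congr
    fun e => by simp

end ProgPred

namespace Tok

/-- Is this symbol part of a formula? -/
def isSym : Tok → Bool
  | sym _ => true
  | _ => false

/-- Does this symbol belong to the index of a variable? -/
def digit : Tok → Bool
  | sym (.bit _) => true
  | sym .endMark => true
  | _ => false

/-- Must the next symbol belong to the index of a variable? -/
def opens : Tok → Bool
  | sym (.bit _) => true
  | sym .var => true
  | _ => false

/-- Two symbols that are never adjacent in a formula. -/
def Clash (a b : Tok) : Prop :=
  a.opens ≠ b.digit ∨ a = sym (.bit false) ∧ b = sym .endMark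

end Tok

/-- No two adjacent symbols clash. -/
def ClashFree (l : List Tok) : Prop :=
  ∀ t, t <:+ l → ¬ ∃ a b, t.head? = some a ∧ t.tail.head? = some b ∧ Tok.Clash a b

/-- The code of a variable. -/
def IsVarCode (s : List Tok) : Prop :=
  s.head? = some (.sym .var) ∧ ClashFree s ∧ (∃ t, t <:+ s ∧ t.head? = some (.sym .endMark)) ∧
    ∀ t, t <:+ s → t.head? = some (.sym .endMark) → t.tail.head? = none

/-- The marks that precede a formula. -/
def IsMark (o : Option Tok) : Prop := o = some .aux ∨ ∃ b, o = some (.sign b)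

/-- The blocks of a certificate: the worlds of a partial model. -/
abbrev Block (c u : List Tok) : Prop :=
  Entry (· = some .world) (fun a => decide (a ≠ .world)) c u

/-- The strings of formulas in a certificate. -/
abbrev Line (c s : List Tok) : Prop := Entry IsMark Tok.isSym c s

/-- The formulas to which a block assigns the value `b`. -/
abbrev Mem (u : List Tok) (b : Bool) (s : List Tok) : Prop :=
  Entry (· = some (.sign b)) Tok.isSym u s

/-- The set of formulas of a certificate is closed under subformulas. -/
def Closed (c : List Tok) : Prop :=
  ∀ s, Line c s → s = [.sym .bot] ∨ IsVarCode s ∨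
    (s.head? = some (.sym .neg) ∧ Line c s.tail) ∨
    ((s.head? = some (.sym .and) ∨ s.head? = some (.sym .cond)) ∧
      ∃ s₁, Line c s₁ ∧ ∃ s₂, Line c s₂ ∧ s.tail = s₁ ++ s₂)

/-- Two formulas have different values in some block. -/
def Separated (c s s' : List Tok) : Prop :=
  ∃ r, Block c r ∧ (Mem r true s ∧ Mem r false s' ∨ Mem r false s ∧ Mem r true s')

/-- The block `t` can be the successor of `u` for the antecedent `s₁` with regard to the conditionals
that have the value `b` in `u`. -/
def IsSuccessor (i : Bool) (c u t s₁ : List Tok) (b : Bool) : Prop :=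
  ∀ s, Mem u b s → s.head? = some (.sym .cond) →
    ∀ s₁', Line c s₁' → ∀ s₂', Line c s₂' → s.tail = s₁' ++ s₂' →
      -- Antecedents that no block separates might have the same truth set, so `t` must serve both
      -- conditionals. As the successor is unique, a conditional and its consequent there have the
      -- same value; with `ID` the antecedent is true there as well.
      Separated c s₁ s₁' ∨ Mem t b s₂' ∧ (i = true → Mem t true s₁')

/-- The local conditions on a block. -/
def IsHintikka (i : Bool) (c u : List Tok) : Prop :=
  (∀ s, Mem u true s → ¬ Mem u false s) ∧
  ¬ Mem u true [.sym .bot] ∧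
  (∀ s, Mem u true s → s.head? = some (.sym .neg) → Mem u false s.tail) ∧
  (∀ s, Mem u false s → s.head? = some (.sym .neg) → Mem u true s.tail) ∧
  (∀ s, Mem u true s → s.head? = some (.sym .and) → ∃ s₁, Line c s₁ ∧ ∃ s₂, Line c s₂ ∧
    s.tail = s₁ ++ s₂ ∧ Mem u true s₁ ∧ Mem u true s₂) ∧
  (∀ s, Mem u false s → s.head? = some (.sym .and) → ∃ s₁, Line c s₁ ∧ ∃ s₂, Line c s₂ ∧
    s.tail = s₁ ++ s₂ ∧ (Mem u false s₁ ∨ Mem u false s₂)) ∧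
  -- Only false conditionals require a successor: a true one may hold because no world is selected.
  (∀ s, Mem u false s → s.head? = some (.sym .cond) → ∀ s₁, Line c s₁ → ∀ s₂, Line c s₂ →
    s.tail = s₁ ++ s₂ → ∃ t, Block c t ∧ IsSuccessor i c u t s₁ true ∧ IsSuccessor i c u t s₁ false)

/-- The certificate `c` shows that `x` does not code a provable formula. -/
def Refutes (i : Bool) (x c : List Tok) : Prop :=
  -- No code of a formula has either of these local faults.
  ((∃ a, x.head? = some a ∧ a.digit = true) ∨ ¬ ClashFree x) ∨ Closed c ∧
    -- Lines of a closed certificate are codes, and codes are prefix-free, so such an `s` shows that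
    -- `x` is not a code.
    ((∃ s, Line c s ∧ s ≠ x ∧ (s <+: x ∨ x <+: s)) ∨
      (∀ u, Block c u → IsHintikka i c u) ∧ ∃ u, Block c u ∧ Mem u false x)

namespace ProgPred

variable {E : Type} [Ctx E] {c f g u t : E → List Tok}

theorem clashFree (hf : Prog f) : ProgPred fun e => ClashFree (f e) := by
  refine forall_suffix hf (not ?_)
  classical
  have h := Prog.cases (g := fun o (p : E × List Tok) =>
    if (∃ a b, o = some a ∧ p.2.tail.head? = some b ∧ Tok.Clash a b) then [default] else [])
    Prog.snd fun o => by
      have := head (fun o' => ∃ a b, o = some a ∧ o' = some b ∧ Tok.Clash a b)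
        (Prog.snd (E := E)).tail
      unfold ProgPred at this
      convert this
  unfold ProgPred
  convert h

theorem isVarCode (hf : Prog f) : ProgPred fun e => IsVarCode (f e) :=
  (head (· = _) hf).and <| (clashFree hf).and <|
    (exists_suffix hf (head (· = _) Prog.snd)).and <|
    forall_suffix hf ((head (· = _) Prog.snd).imp (head (· = none) Prog.snd.tail))

theorem closed (hc : Prog c) : ProgPred fun e => Closed (c e) := by
  refine forall_entry hc ?_
  refine (eq Prog.snd (Prog.single _)).or <| (isVarCode Prog.snd).or <|
    ((head (· = _) Prog.snd).and (entry hc.lift Prog.snd.tail)).or <|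
    ((head (· = _) Prog.snd).or (head (· = _) Prog.snd)).and ?_
  exact exists_entry hc.lift (exists_entry hc.lift.lift
    (eq_append Prog.snd.lift.lift.tail Prog.snd.lift Prog.snd))

theorem separated (hc : Prog c) (hf : Prog f) (hg : Prog g) :
    ProgPred fun e => Separated (c e) (f e) (g e) :=
  exists_entry hc (((entry Prog.snd hf.lift).and (entry Prog.snd hg.lift)).or
    ((entry Prog.snd hf.lift).and (entry Prog.snd hg.lift)))

theorem isSuccessor (i : Bool) (hc : Prog c) (hu : Prog u) (ht : Prog t) (hf : Prog f) (b : Bool) :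
    ProgPred fun e => IsSuccessor i (c e) (u e) (t e) (f e) b :=
  forall_entry hu <| (head (· = _) Prog.snd).imp <| forall_entry hc.lift <|
    forall_entry hc.lift.lift <|
      (eq_append Prog.snd.lift.lift.tail Prog.snd.lift Prog.snd).imp <|
      (separated hc.lift.lift.lift hf.lift.lift.lift Prog.snd.lift).or <|
      (entry ht.lift.lift.lift Prog.snd).and <| (const (i = true)).imp <|
        entry ht.lift.lift.lift Prog.snd.lift

theorem isHintikka (i : Bool) (hc : Prog c) (hu : Prog u) :
    ProgPred fun e => IsHintikka i (c e) (u e) := by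
  refine (forall_entry hu (entry hu.lift Prog.snd).not).and <|
    (entry hu (Prog.single _)).not.and <|
    (forall_entry hu ((head (· = _) Prog.snd).imp (entry hu.lift Prog.snd.tail))).and <|
    (forall_entry hu ((head (· = _) Prog.snd).imp (entry hu.lift Prog.snd.tail))).and <|
    (forall_entry hu ((head (· = _) Prog.snd).imp ?_)).and <|
    (forall_entry hu ((head (· = _) Prog.snd).imp ?_)).and <|
    forall_entry hu ((head (· = _) Prog.snd).imp ?_)
  · exact exists_entry hc.lift <| exists_entry hc.lift.lift <|
      (eq_append Prog.snd.lift.lift.tail Prog.snd.lift Prog.snd).and <|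
      (entry hu.lift.lift.lift Prog.snd.lift).and (entry hu.lift.lift.lift Prog.snd)
  · exact exists_entry hc.lift <| exists_entry hc.lift.lift <|
      (eq_append Prog.snd.lift.lift.tail Prog.snd.lift Prog.snd).and <|
      (entry hu.lift.lift.lift Prog.snd.lift).or (entry hu.lift.lift.lift Prog.snd)
  · exact forall_entry hc.lift <| forall_entry hc.lift.lift <|
      (eq_append Prog.snd.lift.lift.tail Prog.snd.lift Prog.snd).imp <|
      exists_entry hc.lift.lift.lift <|
      (isSuccessor i hc.lift.lift.lift.lift hu.lift.lift.lift.lift Prog.snd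
        Prog.snd.lift.lift true).and
      (isSuccessor i hc.lift.lift.lift.lift hu.lift.lift.lift.lift Prog.snd
        Prog.snd.lift.lift false)

theorem refutes (i : Bool) : ProgPred fun p : List Tok × List Tok => Refutes i p.1 p.2 := by
  have hx : Prog fun p : List Tok × List Tok => p.1 := Prog.self.lift
  have hc : Prog fun p : List Tok × List Tok => p.2 := Prog.snd
  refine ((head (fun o => ∃ a, o = some a ∧ a.digit = true) hx).or (clashFree hx).not).or <| (closed hc).and <|
    (exists_entry (P := fun e s => s ≠ e.1 ∧ (s <+: e.1 ∨ e.1 <+: s)) hc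
      ((eq Prog.snd hx.lift).not.and
      ((prefix_of Prog.snd hx.lift).or (prefix_of hx.lift Prog.snd)))).or <|
    (forall_entry (P := fun e u => IsHintikka i e.2 u) hc (isHintikka i hc.lift Prog.snd)).and
      (exists_entry (P := fun e u => Mem u false e.1) hc (entry Prog.snd hx.lift))

end ProgPred
end Complexity

/-! ### Codes of formulas: local characterisation, prefix-freeness and parsing -/

namespace CondLogic
open Complexity Computability

theorem getLast?_encodePosNum (p : PosNum) : (encodePosNum p).getLast? = some true := by
  induction p with
  | one => rfl
  | bit0 p ih => rw [encodePosNum, List.getLast?_cons, ih]; rfl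
  | bit1 p ih => rw [encodePosNum, List.getLast?_cons, ih]; rfl

/-- The least significant digit comes first, so this forbids leading zeros. With `exists_encodeNat`
it characterises the numerals; in strings it becomes the clash of a digit `0` with the end mark. -/
theorem getLast?_encodeNat (n : ℕ) : (encodeNat n).getLast? ≠ some false := by
  unfold encodeNat
  cases (n : Num) with
  | zero => simp [encodeNum]
  | pos p => simp [encodeNum, getLast?_encodePosNum]

theorem exists_encodePosNum {l : List Bool} (hl : l.getLast? = some true) :
    ∃ p, encodePosNum p = l := by
  induction l with
  | nil => simp at hl
  | cons b l ih =>
    cases l with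
    | nil => exact ⟨.one, by simp_all [encodePosNum]⟩
    | cons b' l =>
      obtain ⟨p, hp⟩ := ih (by simpa [List.getLast?_cons] using hl)
      cases b
      · exact ⟨.bit0 p, by rw [encodePosNum, hp]⟩
      · exact ⟨.bit1 p, by rw [encodePosNum, hp]⟩

theorem exists_encodeNat {l : List Bool} (hl : l.getLast? ≠ some false) :
    ∃ n, encodeNat n = l := by
  cases h : l.getLast? with
  | none => exact ⟨0, by rw [List.getLast?_eq_none_iff.1 h]; rfl⟩
  | some b =>
    cases b with
    | false => exact absurd h hl
    | true =>
      obtain ⟨p, hp⟩ := exists_encodePosNum h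
      exact ⟨((Num.pos p : Num) : ℕ), by rw [encodeNat, Num.of_to_nat]; exact hp⟩

namespace Form

/-- The code of a formula over the work alphabet. -/
def enc (A : Form ℕ) : List Tok := A.encode.map .sym

theorem enc_bot : enc .bot = [.sym .bot] := rfl

theorem enc_var (n : ℕ) : enc (.var n) =
    .sym .var :: ((encodeNat n).map (fun b => Tok.sym (.bit b)) ++ [.sym .endMark]) := by
  simp [enc, encode, Function.comp_def]

theorem enc_neg (A : Form ℕ) : enc (.neg A) = .sym .neg :: A.enc := rfl

theorem enc_and (A B : Form ℕ) : enc (.and A B) = .sym .and :: (A.enc ++ B.enc) := by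
  simp [enc, encode]

theorem enc_cond (A B : Form ℕ) : enc (.cond A B) = .sym .cond :: (A.enc ++ B.enc) := by
  simp [enc, encode]

theorem map_sym_injective : Function.Injective (List.map Tok.sym) :=
  List.map_injective_iff.2 fun _ _ h => by simpa using h

theorem enc_injective : Function.Injective enc := map_sym_injective.comp encode_injective

theorem enc_append_inj {A B : Form ℕ} {s t : List Sym}
    (h : A.enc ++ s.map .sym = B.enc ++ t.map .sym) : A = B ∧ s = t := by
  rw [enc, enc, ← List.map_append, ← List.map_append] at h
  exact encode_append_inj _ _ _ _ (map_sym_injective h)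

theorem eq_of_enc_append {A B A' B' : Form ℕ} (h : A.enc ++ B.enc = A'.enc ++ B'.enc) :
    A = A' ∧ B = B' := by
  obtain ⟨h1, h2⟩ := enc_append_inj h
  exact ⟨h1, encode_injective h2⟩

/-- Codes are prefix-free, by unique readability of prefix notation. -/
theorem eq_of_enc_prefix {A B : Form ℕ} (h : A.enc <+: B.enc) : A = B := by
  obtain ⟨t, ht⟩ := h
  obtain ⟨s₁, s₂, h1, h2, rfl⟩ := List.map_eq_append_iff.1 ht.symm
  rw [enc] at h2
  have := map_sym_injective h2
  subst this
  exact (encode_append_inj A B s₂ [] (by rw [List.append_nil, ← h1])).1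

theorem isSym_of_mem_enc {A : Form ℕ} {a : Tok} (h : a ∈ A.enc) : a.isSym = true := by
  obtain ⟨b, -, rfl⟩ := List.mem_map.1 h
  rfl

theorem head?_enc (A : Form ℕ) : ∃ a, A.enc.head? = some a ∧ a.digit = false := by
  cases A <;> simp [enc, encode, Tok.digit]

end Form

open Form

theorem clashFree_nil : ClashFree [] := by
  rintro t ht ⟨a, b, h, -⟩
  simp [List.suffix_nil.1 ht] at h

theorem clashFree_cons {a : Tok} {l : List Tok} :
    ClashFree (a :: l) ↔ (∀ b, l.head? = some b → ¬ Tok.Clash a b) ∧ ClashFree l := by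
  constructor
  · exact fun h => ⟨fun b hb hab => h _ List.suffix_rfl ⟨a, b, rfl, hb, hab⟩,
      fun t ht => h t (ht.trans (List.suffix_cons _ _))⟩
  · rintro ⟨h1, h2⟩ t ht
    rcases List.suffix_cons_iff.1 ht with rfl | ht
    · rintro ⟨a', b, h, hb, hab⟩
      obtain rfl : a = a' := by simpa using h
      exact h1 b hb hab
    · exact h2 t ht

/-- A string that can follow a formula. -/
def Restart (l : List Tok) : Prop := ClashFree l ∧ ∀ b, l.head? = some b → b.digit = false

theorem Restart.nil : Restart [] := ⟨clashFree_nil, by simp⟩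

theorem clashFree_cons_of_closes {a : Tok} {l : List Tok} (h1 : a.opens = false)
    (h2 : a ≠ .sym (.bit false)) : ClashFree (a :: l) ↔ Restart l := by
  rw [clashFree_cons, Restart, and_comm]
  refine and_congr_right fun _ => forall_congr' fun b => imp_congr_right fun _ => ?_
  rw [Tok.Clash, h1]
  cases b.digit <;> simp [h2]

theorem clashFree_bits {bs : List Bool} (hb : bs.getLast? ≠ some false) {l : List Tok}
    (hl : Restart l) : ClashFree (bs.map (fun b => Tok.sym (.bit b)) ++ .sym .endMark :: l) := by
  induction bs with
  | nil => exact (clashFree_cons_of_closes rfl (by simp)).2 hl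
  | cons b bs ih =>
    rw [List.map_cons, List.cons_append, clashFree_cons]
    cases bs with
    | nil =>
      obtain rfl : b = true := by simpa using hb
      exact ⟨by simp [Tok.Clash, Tok.opens, Tok.digit], ih (by simp)⟩
    | cons b' bs =>
      exact ⟨by simp [Tok.Clash, Tok.opens, Tok.digit], ih (by simpa [List.getLast?_cons] using hb)⟩

theorem Form.restart_enc_append (A : Form ℕ) {l : List Tok} (hl : Restart l) :
    Restart (A.enc ++ l) := by
  refine ⟨?_, fun b hb => ?_⟩
  · induction A generalizing l with
    | bot => exact (clashFree_cons_of_closes rfl (by simp)).2 hl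
    | var n =>
      rw [enc_var, List.cons_append, clashFree_cons, List.append_assoc]
      refine ⟨?_, clashFree_bits (getLast?_encodeNat n) hl⟩
      cases encodeNat n <;> simp [Tok.Clash, Tok.opens, Tok.digit]
    | neg A ih =>
      obtain ⟨a, ha, ha'⟩ := A.head?_enc
      rw [enc_neg, List.cons_append]
      exact (clashFree_cons_of_closes rfl (by simp)).2 ⟨ih hl, by simp [ha, ha']⟩
    | and A B ih ih' =>
      obtain ⟨a, ha, ha'⟩ := A.head?_enc
      obtain ⟨b, hb, hb'⟩ := B.head?_enc
      rw [enc_and, List.cons_append, List.append_assoc]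
      exact (clashFree_cons_of_closes rfl (by simp)).2
        ⟨ih ⟨ih' hl, by simp [hb, hb']⟩, by simp [ha, ha']⟩
    | cond A B ih ih' =>
      obtain ⟨a, ha, ha'⟩ := A.head?_enc
      obtain ⟨b, hb, hb'⟩ := B.head?_enc
      rw [enc_cond, List.cons_append, List.append_assoc]
      exact (clashFree_cons_of_closes rfl (by simp)).2
        ⟨ih ⟨ih' hl, by simp [hb, hb']⟩, by simp [ha, ha']⟩
  · obtain ⟨a, ha, ha'⟩ := A.head?_enc
    obtain rfl : a = b := by simpa [ha] using hb
    exact ha'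

theorem Form.restart_enc (A : Form ℕ) : Restart A.enc := by
  simpa using A.restart_enc_append .nil

/-- After `var` or a digit, the absence of clashes forces a digit or the end mark, so the string
runs out or a numeral is completed. The last clause carries the ban on leading zeros through the
induction. -/
theorem bits_of_clashFree {y : List Tok} (hs : ∀ a ∈ y, a.isSym = true) {a : Tok}
    (ha : a.opens = true) (hc : ClashFree (a :: y)) :
    ∃ bs : List Bool, y = bs.map (fun b => Tok.sym (.bit b)) ∨
      ∃ r, y = bs.map (fun b => Tok.sym (.bit b)) ++ .sym .endMark :: r ∧ Restart r ∧
        bs.getLast? ≠ some false ∧ (bs = [] → a ≠ .sym (.bit false)) := by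
  induction y generalizing a with
  | nil => exact ⟨[], .inl rfl⟩
  | cons b y ih =>
    rw [clashFree_cons] at hc
    have hb := hc.1 b rfl
    simp only [Tok.Clash, ha, not_or, not_not, not_and] at hb
    obtain ⟨hb, hb'⟩ := hb
    rcases b with (_ | _ | _ | _ | _ | b | _) | _ | _ | _ <;> simp [Tok.digit] at hb
    · obtain ⟨bs, rfl | ⟨r, rfl, h1, h2, h3⟩⟩ := ih (fun a h => hs a (by simp [h])) rfl hc.2
      · exact ⟨b :: bs, .inl rfl⟩
      · refine ⟨b :: bs, .inr ⟨r, rfl, h1, ?_, by simp⟩⟩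
        cases bs with
        | nil => simpa using h3
        | cons b' bs => simpa [List.getLast?_cons] using h2
    · exact ⟨[], .inr ⟨y, rfl, (clashFree_cons_of_closes rfl (by simp)).1 hc.2, by simp,
        fun _ h => hb' h rfl⟩⟩

/-- Recursive descent: without local faults the parser can fail only by reaching the end of the
string. Missing arguments are then filled with `⊥`, which keeps the completed code linear in the
length of the string. -/
theorem Form.exists_parse : ∀ (n : ℕ) (X : List Tok), X.length ≤ n → (∀ a ∈ X, a.isSym = true) →
    Restart X → ∃ A : Form ℕ, (∃ r, X = A.enc ++ r ∧ Restart r) ∨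
      X <+: A.enc ∧ A.enc.length ≤ 2 * X.length + 1 := by
  intro n
  induction n with
  | zero =>
    intro X hX _ _
    obtain rfl := List.length_eq_zero_iff.1 (Nat.le_zero.1 hX)
    exact ⟨.bot, .inr ⟨List.nil_prefix, by simp [enc_bot]⟩⟩
  | succ n ih =>
    intro X hX hs hr
    rcases X with _ | ⟨a, y⟩
    · exact ⟨.bot, .inr ⟨List.nil_prefix, by simp [enc_bot]⟩⟩
    have hy : y.length ≤ n := by simpa using hX
    have hsy : ∀ a ∈ y, a.isSym = true := fun a h => hs a (by simp [h])
    have ha := hs a (by simp)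
    have ha' := hr.2 a rfl
    have two : ∀ (k : Tok) (f : Form ℕ → Form ℕ → Form ℕ),
        (∀ A B, (f A B).enc = k :: (A.enc ++ B.enc)) → Restart y →
        ∃ A : Form ℕ, (∃ r, k :: y = A.enc ++ r ∧ Restart r) ∨
          k :: y <+: A.enc ∧ A.enc.length ≤ 2 * (k :: y).length + 1 := by
      intro k f hf hry
      obtain ⟨A, ⟨r, rfl, h2⟩ | ⟨h1, h2⟩⟩ := ih y hy hsy hry
      · obtain ⟨B, ⟨r', rfl, h3⟩ | ⟨h3, h4⟩⟩ := ih r (by simp at hy; omega)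
          (fun a h => hsy a (by simp [h])) h2
        · exact ⟨f A B, .inl ⟨r', by simp [hf], h3⟩⟩
        · refine ⟨f A B, .inr ⟨?_, ?_⟩⟩
          · rw [hf, List.cons_prefix_cons]
            exact ⟨rfl, (List.prefix_append_right_inj _).2 h3⟩
          · simp [hf]; omega
      -- The string ends within the first argument, so the second one is free.
      · refine ⟨f A .bot, .inr ⟨?_, ?_⟩⟩
        · rw [hf, List.cons_prefix_cons]
          exact ⟨rfl, h1.trans (List.prefix_append _ _)⟩
        · simp [hf, enc_bot]; omega
    rcases a with (_ | _ | _ | _ | _ | b | _) | _ | _ | _ <;> simp [Tok.digit, Tok.isSym] at ha ha'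
    · exact ⟨.bot, .inl ⟨y, rfl, (clashFree_cons_of_closes rfl (by simp)).1 hr.1⟩⟩
    · obtain ⟨bs, rfl | ⟨r, rfl, h1, h2, -⟩⟩ := bits_of_clashFree hsy rfl hr.1
      -- The string ends within a numeral. A further digit `1` makes any digits a numeral without
      -- leading zeros.
      · obtain ⟨m, hm⟩ := exists_encodeNat (l := bs ++ [true]) (by simp)
        refine ⟨.var m, .inr ⟨?_, ?_⟩⟩
        · rw [enc_var, hm, List.cons_prefix_cons, List.map_append, List.append_assoc]
          exact ⟨rfl, List.prefix_append _ _⟩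
        · simp [enc_var, hm]; omega
      · obtain ⟨m, hm⟩ := exists_encodeNat h2
        exact ⟨.var m, .inl ⟨r, by simp [enc_var, hm], h1⟩⟩
    · have hry := (clashFree_cons_of_closes rfl (by simp)).1 hr.1
      obtain ⟨A, ⟨r, rfl, h2⟩ | ⟨h1, h2⟩⟩ := ih y hy hsy hry
      · exact ⟨.neg A, .inl ⟨r, rfl, h2⟩⟩
      · refine ⟨.neg A, .inr ⟨List.cons_prefix_cons.2 ⟨rfl, h1⟩, ?_⟩⟩
        simp [enc_neg]; omega
    · exact two _ .and enc_and ((clashFree_cons_of_closes rfl (by simp)).1 hr.1)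
    · exact two _ .cond enc_cond ((clashFree_cons_of_closes rfl (by simp)).1 hr.1)

theorem isVarCode_enc (n : ℕ) : IsVarCode (enc (.var n)) := by
  refine ⟨by simp [enc_var], (restart_enc _).1, ⟨[.sym .endMark], ?_, rfl⟩, fun t ht hh => ?_⟩
  · rw [enc_var, ← List.cons_append]
    exact List.suffix_append _ _
  · rw [enc_var, ← List.cons_append] at ht
    rcases List.suffix_concat_iff.1 ht with rfl | ⟨t', rfl, ht'⟩
    · simp at hh
    · rcases t' with _ | ⟨a, t'⟩
      · rfl
      · obtain rfl : a = .sym .endMark := by simpa using hh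
        have := ht'.subset (List.mem_cons_self (l := t'))
        simp at this

theorem exists_eq_enc_var {s : List Tok} (hs : ∀ a ∈ s, a.isSym = true) (h : IsVarCode s) :
    ∃ n, s = enc (.var n) := by
  obtain ⟨h1, h2, ⟨t, ht, ht'⟩, h4⟩ := h
  rcases s with _ | ⟨a, y⟩
  · simp at h1
  obtain rfl : a = .sym .var := by simpa using h1
  obtain ⟨bs, rfl | ⟨r, rfl, h5, h6, -⟩⟩ := bits_of_clashFree (fun a h => hs a (by simp [h])) rfl h2
  · have := ht.subset (List.mem_of_mem_head? ht')
    simp at this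
  · obtain ⟨m, hm⟩ := exists_encodeNat h6
    have := h4 (.sym .endMark :: r) ⟨_ :: bs.map (fun b => Tok.sym (.bit b)), rfl⟩ rfl
    obtain rfl : r = [] := by simpa using this
    exact ⟨m, by rw [enc_var, hm]⟩

theorem isSym_of_line {c s : List Tok} (h : Line c s) : ∀ a ∈ s, a.isSym = true := by
  obtain ⟨t, -, -, rfl⟩ := h
  exact fun a ha => List.mem_takeWhile_imp ha

theorem cons_of_head? {a : Tok} {s : List Tok} (h : s.head? = some a) : s = a :: s.tail := by
  rcases s with _ | ⟨b, s⟩ <;> simp_all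

/-- The verifier contains no parser: closure under immediate subformulas, by induction on the
length, forces every line to be a code. -/
theorem exists_enc_of_line {c s : List Tok} (hc : Closed c) (hl : Line c s) :
    ∃ A : Form ℕ, s = A.enc := by
  suffices h : ∀ (n : ℕ) (s : List Tok), s.length ≤ n → Line c s → ∃ A : Form ℕ, s = A.enc from
    h _ s le_rfl hl
  clear! s
  intro n
  induction n with
  | zero =>
    intro s hs hl
    obtain rfl := List.length_eq_zero_iff.1 (Nat.le_zero.1 hs)
    rcases hc _ hl with h | ⟨h, -⟩ | ⟨h, -⟩ | ⟨h, -⟩ <;> simp at h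
  | succ n ih =>
    intro s hs hl
    rcases hc _ hl with rfl | h | ⟨h, hl'⟩ | ⟨h, s₁, h1, s₂, h2, h3⟩
    · exact ⟨.bot, rfl⟩
    · obtain ⟨m, hm⟩ := exists_eq_enc_var (isSym_of_line hl) h
      exact ⟨_, hm⟩
    · obtain ⟨A, hA⟩ := ih _ (by rw [List.length_tail]; omega) hl'
      exact ⟨.neg A, by rw [cons_of_head? h, hA, enc_neg]⟩
    · have hlen := congrArg List.length h3
      rw [List.length_tail, List.length_append] at hlen
      have hpos : 0 < s.length := by
        rcases s with _ | _
        · simp at h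
        · simp
      obtain ⟨A, rfl⟩ := ih _ (by omega) h1
      obtain ⟨B, rfl⟩ := ih _ (by omega) h2
      rcases h with h | h
      · exact ⟨.and A B, by rw [cons_of_head? h, h3, enc_and]⟩
      · exact ⟨.cond A B, by rw [cons_of_head? h, h3, enc_cond]⟩

end CondLogic

/-! ### Soundness of refutations -/

namespace CondLogic
open Complexity Form

namespace SelModel

open Classical in
/-- The extension of a model by a root whose successors are given by a relation. -/
noncomputable def addRoot (M : SelModel) (P : Set M.W → M.W → Prop) (v : ℕ → Prop) : SelModel where
  W := Option M.W
  sel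
    | some m, X => (M.sel m (some ⁻¹' X)).map some
    | none, X => if h : ∃ m, P (some ⁻¹' X) m then some (some h.choose) else none
  val
    | some m, p => M.val m p
    | none, p => v p

variable {M : SelModel} {P : Set M.W → M.W → Prop} {v : ℕ → Prop}

/-- Selections at old worlds disregard whether the root belongs to a proposition, so truth at old
worlds is unchanged. -/
theorem addRoot_holds_some (A : Form ℕ) :
    ∀ m : M.W, (M.addRoot P v).Holds (some m) A ↔ M.Holds m A := by
  induction A with
  | bot => exact fun m => Iff.rfl
  | var p => exact fun m => Iff.rfl
  | neg A ih => exact fun m => not_congr (ih m)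
  | and A B ih ih' => exact fun m => and_congr (ih m) (ih' m)
  | cond A B ih ih' =>
    intro m
    have h : (some ⁻¹' {w | (M.addRoot P v).Holds w A} : Set M.W) = {w | M.Holds w A} :=
      Set.ext ih
    have hs : (M.addRoot P v).sel (some m) {w | (M.addRoot P v).Holds w A} =
        (M.sel m {w | M.Holds w A}).map some := by
      rw [← h]; rfl
    simp only [Holds, hs]
    cases M.sel m {w | M.Holds w A} with
    | none => simp
    | some u =>
      refine ⟨fun h v hv => ?_, fun h w hw => ?_⟩
      · obtain rfl := Option.some_inj.1 hv
        exact (ih' u).1 (h _ rfl)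
      · obtain rfl := Option.some_inj.1 hw
        exact (ih' u).2 (h _ rfl)

/-- The root's selection depends only on the truth set among the old worlds, so the value of the
antecedent at the root is irrelevant. -/
theorem addRoot_sel_none (A : Form ℕ) :
    (∃ m, P {w | M.Holds w A} m ∧
      (M.addRoot P v).sel none {w | (M.addRoot P v).Holds w A} = some (some m)) ∨
    (¬ ∃ m, P {w | M.Holds w A} m) ∧
      (M.addRoot P v).sel none {w | (M.addRoot P v).Holds w A} = none := by
  have h : (some ⁻¹' {w | (M.addRoot P v).Holds w A} : Set M.W) = {w | M.Holds w A} :=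
    Set.ext (addRoot_holds_some A)
  rw [← h]
  by_cases hm : ∃ m, P (some ⁻¹' {w | (M.addRoot P v).Holds w A}) m
  · exact .inl ⟨_, hm.choose_spec, dif_pos hm⟩
  · exact .inr ⟨hm, dif_neg hm⟩

theorem addRoot_identity (hM : M.Identity) (hP : ∀ X m, P X m → m ∈ X) :
    (M.addRoot P v).Identity := by
  rintro (_ | m) X w h
  · by_cases hm : ∃ m, P (some ⁻¹' X) m
    · have h' : (M.addRoot P v).sel none X = some (some hm.choose) := dif_pos hm
      obtain rfl := Option.some_inj.1 (h'.symm.trans h)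
      exact hP _ _ hm.choose_spec
    · have h' : (M.addRoot P v).sel none X = none := dif_neg hm
      rw [h'] at h
      simp at h
  · obtain ⟨u, hu, rfl⟩ := Option.map_eq_some_iff.1 h
    exact hM _ _ _ hu

end SelModel

/-- The nesting depth of conditionals. -/
def Form.depth : Form ℕ → ℕ
  | .bot => 0
  | .var _ => 0
  | .neg A => A.depth
  | .and A B => max A.depth B.depth
  | .cond A B => max A.depth B.depth + 1

/-- The mark `world` is not part of a formula, so a formula cut out of a block is also cut out of
the whole certificate. -/
theorem line_of_mem {c u s : List Tok} {b : Bool} (hu : Block c u) (hs : Mem u b s) : Line c s := by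
  obtain ⟨t₀, h1, -, rfl⟩ := hu
  obtain ⟨t, h2, h3, rfl⟩ := hs
  obtain ⟨a, t, rfl⟩ : ∃ a t', t = a :: t' := by
    cases t
    · simp at h3
    · exact ⟨_, _, rfl⟩
  have h4 := List.takeWhile_append_dropWhile (p := fun a => decide (a ≠ Tok.world)) (l := t₀.tail)
  have h5 : (t₀.tail.dropWhile fun a => decide (a ≠ Tok.world)).takeWhile Tok.isSym = [] := by
    rcases hd : t₀.tail.dropWhile fun a => decide (a ≠ Tok.world) with _ | ⟨a, r⟩
    · rfl
    · have := List.head?_dropWhile_not (fun a => decide (a ≠ Tok.world)) t₀.tail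
      rw [hd] at this
      obtain rfl : a = .world := by simpa using this
      rfl
  refine ⟨a :: t ++ t₀.tail.dropWhile fun a => decide (a ≠ Tok.world), ?_, .inr ⟨b, by simpa using h3⟩,
    ?_⟩
  · obtain ⟨q, hq⟩ := h2
    refine List.IsSuffix.trans ⟨q, ?_⟩ ((List.tail_suffix t₀).trans h1)
    rw [← List.append_assoc, hq, h4]
  · simp only [List.cons_append, List.tail_cons, List.takeWhile_append, h5]
    split_ifs with h
    · rw [List.append_nil, (List.takeWhile_prefix _).eq_of_length h]
    · rfl

/-- The theory of a world agrees with a block on formulas of bounded depth. -/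
def Agree (u : List Tok) (d : ℕ) (T : Set (Form ℕ)) : Prop :=
  ∀ b (A : Form ℕ), Mem u b A.enc → A.depth ≤ d → (A ∈ T ↔ b = true)

/-- Successor blocks may form cycles, so the induction is on the depth `d`, for all blocks at once.
A block is realised at a new root over the canonical model, with worlds that realise its successor
blocks up to depth `d - 1`. -/
theorem exists_agree {i : Bool} {c : List Tok} (hc : Closed c)
    (hH : ∀ u, Block c u → IsHintikka i c u) (d : ℕ) :
    ∀ u, Block c u → ∃ T : (canon i).W, Agree u d T.1 := by
  induction d using Nat.strong_induction_on with | _ d IH => ?_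
  intro u hu
  obtain ⟨hcons, hbot, hneg, hneg', hand, hand', hcond⟩ := hH u hu
  have line_cond : ∀ b A B, Mem u b (enc (.cond A B)) → Line c A.enc ∧ Line c B.enc := by
    intro b A B h
    rcases hc _ (line_of_mem hu h) with h | ⟨h, -⟩ | ⟨h, -⟩ | ⟨-, s₁, h1, s₂, h2, h3⟩
    · simp [enc_cond] at h
    · simp [enc_cond] at h
    · simp [enc_cond] at h
    · obtain ⟨A', rfl⟩ := exists_enc_of_line hc h1
      obtain ⟨B', rfl⟩ := exists_enc_of_line hc h2
      obtain ⟨rfl, rfl⟩ := eq_of_enc_append (show A.enc ++ B.enc = _ by simpa [enc_cond] using h3)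
      exact ⟨h1, h2⟩
  -- A separating block is realised up to depth `d - 1` by a canonical world, which would belong to
  -- just one of the two truth sets.
  have not_sep : ∀ A B : Form ℕ, A.depth < d → B.depth < d →
      {S : (canon i).W | A ∈ S.1} = {S | B ∈ S.1} → ¬ Separated c A.enc B.enc := by
    rintro A B hA hB h ⟨r, hr, h1⟩
    obtain ⟨m, hm⟩ := IH (d - 1) (by omega) r hr
    have h2 : A ∈ m.1 ↔ B ∈ m.1 := Set.ext_iff.1 h m
    rcases h1 with ⟨h3, h4⟩ | ⟨h3, h4⟩ <;>
    · rw [hm _ _ h3 (by omega), hm _ _ h4 (by omega)] at h2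
      simp at h2
  have succ_spec : ∀ A t b A' B', IsSuccessor i c u t A.enc b → A.depth < d →
      Mem u b (enc (.cond A' B')) → depth (.cond A' B') ≤ d →
      {S : (canon i).W | A ∈ S.1} = {S | A' ∈ S.1} →
      Mem t b B'.enc ∧ (i = true → Mem t true A'.enc) := by
    intro A t b A' B' ht hA hm hd h
    simp only [depth] at hd
    have hl := line_cond _ _ _ hm
    exact (ht _ hm (by simp [enc_cond]) _ hl.1 _ hl.2 (by simp [enc_cond])).resolve_left
      (not_sep _ _ hA (by omega) h)
  -- For the proposition `X` the root may select a world that realises a successor block of some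
  -- false conditional whose antecedent has truth set `X`. Without such a conditional nothing is
  -- selected.
  let P : Set (canon i).W → (canon i).W → Prop := fun X m => ∃ A B t,
    Mem u false (enc (.cond A B)) ∧ depth (.cond A B) ≤ d ∧ X = {S | A ∈ S.1} ∧
    IsSuccessor i c u t A.enc true ∧ IsSuccessor i c u t A.enc false ∧ Agree t (d - 1) m.1
  let M := (canon i).addRoot P fun p => Mem u true (enc (.var p))
  have hM : i = true → M.Identity := by
    rintro rfl
    refine SelModel.addRoot_identity canon_identity ?_
    rintro _ m ⟨A, B, t, h1, h2, rfl, h3, h4, h5⟩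
    have h6 := (succ_spec A t false A B h4 (by simp only [depth] at h2; omega) h1 h2 rfl).2 rfl
    exact (h5 _ _ h6 (by simp only [depth] at h2; omega)).2 rfl
  -- By soundness the theory of the root is itself a world of the canonical model.
  refine ⟨⟨_, SelModel.isWorld_theory hM none⟩, ?_⟩
  suffices h : ∀ A : Form ℕ, ∀ b, Mem u b A.enc → A.depth ≤ d → (M.Holds none A ↔ b = true) from
    fun b A => h A b
  intro A
  induction A with
  | bot =>
    rintro (_ | _) hm hd
    · simp [SelModel.Holds]
    · exact absurd hm hbot
  | var p =>
    rintro (_ | _) hm hd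
    · exact iff_of_false (fun h => hcons _ h hm) (by simp)
    · exact iff_of_true hm rfl
  | neg A ih =>
    rintro (_ | _) hm hd
    · have := ih _ (hneg' _ hm (by simp [enc_neg])) hd
      simpa [SelModel.Holds] using this
    · have := ih _ (hneg _ hm (by simp [enc_neg])) hd
      simpa [SelModel.Holds] using this
  | and A B ih ih' =>
    simp only [depth, max_le_iff]
    rintro (_ | _) hm hd
    · obtain ⟨s₁, h1, s₂, h2, h3, h4⟩ := hand' _ hm (by simp [enc_and])
      obtain ⟨A', rfl⟩ := exists_enc_of_line hc h1
      obtain ⟨B', rfl⟩ := exists_enc_of_line hc h2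
      obtain ⟨rfl, rfl⟩ := eq_of_enc_append (show A.enc ++ B.enc = _ by simpa [enc_and] using h3)
      refine iff_of_false ?_ (by simp)
      rintro ⟨h5, h6⟩
      rcases h4 with h4 | h4
      · simpa using (ih _ h4 hd.1).1 h5
      · simpa using (ih' _ h4 hd.2).1 h6
    · obtain ⟨s₁, h1, s₂, h2, h3, h4, h5⟩ := hand _ hm (by simp [enc_and])
      obtain ⟨A', rfl⟩ := exists_enc_of_line hc h1
      obtain ⟨B', rfl⟩ := exists_enc_of_line hc h2
      obtain ⟨rfl, rfl⟩ := eq_of_enc_append (show A.enc ++ B.enc = _ by simpa [enc_and] using h3)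
      exact iff_of_true ⟨(ih _ h4 hd.1).2 rfl, (ih' _ h5 hd.2).2 rfl⟩ rfl
  | cond A B _ _ =>
    intro b hm hd
    have hX : {w | (canon i).Holds w A} = {S | A ∈ S.1} := Set.ext (canon_holds A)
    have hd' := hd
    simp only [depth] at hd'
    rcases SelModel.addRoot_sel_none (M := canon i) (P := P)
      (v := fun p => Mem u true (enc (.var p))) A with ⟨m, hP, hs⟩ | ⟨hP, hs⟩
    · have h0 : M.Holds none (.cond A B) ↔ B ∈ m.1 := by
        rw [← canon_holds, ← SelModel.addRoot_holds_some (P := P)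
          (v := fun p => Mem u true (enc (.var p)))]
        exact ⟨fun h => h _ hs, fun h w hw => by
          obtain rfl := Option.some_inj.1 (hs.symm.trans hw); exact h⟩
      -- The selected world may stem from another conditional `A' ⇒ B'`, but `A'` and `A` have the
      -- same truth set, so `t` also gives `B` the value `b`.
      obtain ⟨A', B', t, h1, h2, h3, h4, h5, h6⟩ := hP
      have h7 : IsSuccessor i c u t A'.enc b := by cases b <;> assumption
      have h8 := succ_spec A' t b A B h7 (by simp only [depth] at h2; omega) hm hd
        (h3.symm.trans hX)
      rw [h0, h6 _ _ h8.1 (by omega)]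
    -- Nothing is selected and the conditional is vacuously true. The value `false` is impossible,
    -- since its successor block, realised by `IH`, would make `P` satisfiable.
    · have h0 : M.Holds none (.cond A B) := fun w hw => by
        rw [show M.sel none _ = none from hs] at hw
        simp at hw
      refine iff_of_true h0 ?_
      cases b with
      | true => rfl
      | false =>
        have hl := line_cond _ _ _ hm
        obtain ⟨t, h1, h2, h3⟩ := hcond _ hm (by simp [enc_cond]) _ hl.1 _ hl.2 (by simp [enc_cond])
        obtain ⟨m, hm'⟩ := IH (d - 1) (by omega) t h1
        exact absurd ⟨m, A, B, t, hm, hd, hX, h2, h3, hm'⟩ hP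

/-- Refutations are sound. -/
theorem not_derivable_of_refutes {i : Bool} {A : Form ℕ} {c : List Tok} (h : Refutes i A.enc c) :
    ¬ HDerivable (system i) A := by
  intro hA
  rcases h with (⟨a, h1, h2⟩ | h) | ⟨hc, ⟨s, h1, h2, h3⟩ | ⟨h1, u, h2, h3⟩⟩
  · obtain ⟨b, hb, hb'⟩ := A.head?_enc
    rw [hb, Option.some_inj] at h1
    simp_all
  · exact h A.restart_enc.1
  · obtain ⟨B, rfl⟩ := exists_enc_of_line hc h1
    rcases h3 with h3 | h3
    · exact h2 (congrArg enc (eq_of_enc_prefix h3))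
    · exact h2 (congrArg enc (eq_of_enc_prefix h3)).symm
  · obtain ⟨T, hT⟩ := exists_agree hc h1 A.depth u h2
    simpa using (hT _ _ h3 le_rfl).1 (T.2.der hA)

end CondLogic

/-! ### Reading entries from marked lists -/

namespace Complexity

/-- Concatenation of strings, each preceded by its mark. -/
def flat (l : List (Tok × List Tok)) : List Tok := l.flatMap fun e => e.1 :: e.2

section Entry

variable {p : Option Tok → Prop} {q : Tok → Bool} {l s : List Tok}

theorem entry_nil (hp : ¬ p none) : ¬ Entry p q [] s := by
  rintro ⟨t, ht, h, -⟩
  rw [List.suffix_nil.1 ht] at h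
  exact hp h

theorem entry_cons {a : Tok} :
    Entry p q (a :: l) s ↔ p (some a) ∧ l.takeWhile q = s ∨ Entry p q l s := by
  constructor
  · rintro ⟨t, ht, h⟩
    rcases List.suffix_cons_iff.1 ht with rfl | ht
    · exact .inl h
    · exact .inr ⟨t, ht, h⟩
  · rintro (h | ⟨t, ht, h⟩)
    · exact ⟨_, List.suffix_rfl, h⟩
    · exact ⟨t, ht.trans (List.suffix_cons _ _), h⟩

theorem entry_append (hp : ∀ o, p o → ∃ k, o = some k ∧ q k = false) {t : List Tok}
    (ht : ∀ a ∈ t, q a = true) : Entry p q (t ++ l) s ↔ Entry p q l s := by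
  induction t with
  | nil => rfl
  | cons a t ih =>
    rw [List.cons_append, entry_cons, ih fun a h => ht a (by simp [h]), or_iff_right]
    rintro ⟨h, -⟩
    obtain ⟨k, hk, hq⟩ := hp _ h
    obtain rfl := Option.some_inj.1 hk
    simp [ht] at hq

/-- Marks violate `q` and texts satisfy it, so cutting after a mark stops exactly at the next one.
-/
theorem entry_flat (hp : ∀ o, p o → ∃ k, o = some k ∧ q k = false) {m : List (Tok × List Tok)}
    (hm : ∀ e ∈ m, q e.1 = false ∧ ∀ a ∈ e.2, q a = true) :
    Entry p q (flat m) s ↔ ∃ e ∈ m, p (some e.1) ∧ e.2 = s := by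
  induction m with
  | nil => simpa [flat] using entry_nil fun h => by obtain ⟨k, hk, -⟩ := hp _ h; simp at hk
  | cons e m ih =>
    have he := hm e (by simp)
    have h1 : (e.2 ++ flat m).takeWhile q = e.2 := by
      rw [List.takeWhile_append_of_pos he.2]
      rcases m with _ | ⟨e', m⟩
      · simp [flat]
      · simp [flat, (hm e' (by simp)).1]
    have h2 : flat (e :: m) = e.1 :: (e.2 ++ flat m) := by simp [flat]
    rw [h2, entry_cons, h1, entry_append hp he.2, ih fun e h => hm e (by simp [h])]
    simp

end Entry

theorem length_flatMap_le {α β : Type} {l : List α} {f : α → List β} {k : ℕ}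
    (h : ∀ a ∈ l, (f a).length ≤ k) : (l.flatMap f).length ≤ l.length * k := by
  induction l with
  | nil => simp
  | cons a l ih =>
    have h1 := h a (by simp)
    have h2 := ih fun a h' => h a (by simp [h'])
    rw [List.flatMap_cons, List.length_append, List.length_cons, Nat.succ_mul]
    omega

end Complexity

/-! ### Completeness: short certificates from models -/

namespace CondLogic
open Complexity Form

/-- The subformulas of a formula. -/
def Form.subs : Form ℕ → List (Form ℕ)
  | .bot => [.bot]
  | .var p => [.var p]
  | .neg A => .neg A :: A.subs
  | .and A B => .and A B :: (A.subs ++ B.subs)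
  | .cond A B => .cond A B :: (A.subs ++ B.subs)

namespace Form

theorem self_mem_subs (A : Form ℕ) : A ∈ A.subs := by cases A <;> simp [subs]

theorem subs_trans {A B C : Form ℕ} (h : A ∈ B.subs) (h' : B ∈ C.subs) : A ∈ C.subs := by
  induction C with
  | bot | var p => simp only [subs, List.mem_singleton] at h'; subst h'; exact h
  | neg C ih =>
    simp only [subs, List.mem_cons] at h' ⊢
    rcases h' with rfl | h'
    · simpa [subs] using h
    · exact .inr (ih h')
  | and C D ih ih' | cond C D ih ih' =>
    simp only [subs, List.mem_cons, List.mem_append] at h' ⊢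
    rcases h' with rfl | h' | h'
    · simpa [subs] using h
    · exact .inr (.inl (ih h'))
    · exact .inr (.inr (ih' h'))

theorem length_subs_le (A : Form ℕ) : A.subs.length ≤ A.enc.length := by
  induction A with
  | bot => simp [subs, enc_bot]
  | var p => simp [subs, enc_var]
  | neg A ih => simpa [subs, enc_neg] using ih
  | and A B ih ih' => simp only [subs, enc_and, List.length_cons, List.length_append]; omega
  | cond A B ih ih' => simp only [subs, enc_cond, List.length_cons, List.length_append]; omega

theorem length_enc_le {A B : Form ℕ} (h : A ∈ B.subs) : A.enc.length ≤ B.enc.length := by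
  induction B with
  | bot | var p => simp only [subs, List.mem_singleton] at h; rw [h]
  | neg B ih =>
    simp only [subs, List.mem_cons] at h
    rcases h with rfl | h
    · exact le_rfl
    · exact (ih h).trans (by simp [enc_neg])
  | and B C ih ih' | cond B C ih ih' =>
    simp only [subs, List.mem_cons, List.mem_append] at h
    rcases h with rfl | h | h
    · exact le_rfl
    · exact (ih h).trans (by simp only [enc_and, enc_cond, List.length_cons, List.length_append]; omega)
    · exact (ih' h).trans (by simp only [enc_and, enc_cond, List.length_cons, List.length_append]; omega)

theorem neg_mem_subs {A F : Form ℕ} (h : A.neg ∈ F.subs) : A ∈ F.subs :=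
  subs_trans (by simp [subs, self_mem_subs]) h

theorem and_mem_subs {A B F : Form ℕ} (h : A.and B ∈ F.subs) : A ∈ F.subs ∧ B ∈ F.subs :=
  ⟨subs_trans (by simp [subs, self_mem_subs]) h, subs_trans (by simp [subs, self_mem_subs]) h⟩

theorem cond_mem_subs {A B F : Form ℕ} (h : A.cond B ∈ F.subs) : A ∈ F.subs ∧ B ∈ F.subs :=
  ⟨subs_trans (by simp [subs, self_mem_subs]) h, subs_trans (by simp [subs, self_mem_subs]) h⟩

theorem neg_of_head? {A : Form ℕ} (h : A.enc.head? = some (.sym .neg)) :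
    ∃ B, A = .neg B := by
  cases A <;> simp [enc, encode] at h ⊢

theorem and_of_head? {A : Form ℕ} (h : A.enc.head? = some (.sym .and)) :
    ∃ B C, A = .and B C := by
  cases A <;> simp [enc, encode] at h ⊢

theorem cond_of_head? {A : Form ℕ} (h : A.enc.head? = some (.sym .cond)) :
    ∃ B C, A = .cond B C := by
  cases A <;> simp [enc, encode] at h ⊢

end Form

variable {M : SelModel}

open Classical in
/-- The formulas that a list of pairs evaluates at a world, with their truth values. -/
noncomputable def items (E : List (M.W × Form ℕ)) (w : M.W) : List (Tok × List Tok) :=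
  (E.filter fun e => e.1 = w).map fun e => (.sign (M.Holds w e.2), e.2.enc)

/-- The certificate that describes a part of a model. -/
noncomputable def certificate (F : Form ℕ) (E : List (M.W × Form ℕ)) : List Tok :=
  flat (F.subs.map fun A => (.aux, A.enc)) ++
    flat ((E.map Prod.fst).map fun w => (.world, flat (items E w)))

section Certificate

variable {F : Form ℕ} {E : List (M.W × Form ℕ)}

open Classical in
theorem mem_items {w : M.W} {e : Tok × List Tok} :
    e ∈ items E w ↔ ∃ A, (w, A) ∈ E ∧ e = (.sign (M.Holds w A), A.enc) := by
  simp only [items, List.mem_map, List.mem_filter, decide_eq_true_eq, Prod.exists]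
  constructor
  · rintro ⟨w', A, ⟨h1, rfl⟩, rfl⟩
    exact ⟨A, h1, rfl⟩
  · rintro ⟨A, h1, rfl⟩
    exact ⟨w, A, ⟨h1, rfl⟩, rfl⟩

open Classical in
theorem mem_block {w : M.W} {b : Bool} {s : List Tok} :
    Mem (flat (items E w)) b s ↔ ∃ A, (w, A) ∈ E ∧ s = A.enc ∧ (M.Holds w A ↔ b = true) := by
  refine (entry_flat (by rintro _ rfl; exact ⟨_, rfl, rfl⟩) fun e he => ?_).trans ?_
  · obtain ⟨A, -, rfl⟩ := mem_items.1 he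
    exact ⟨rfl, fun a => isSym_of_mem_enc⟩
  constructor
  · rintro ⟨e, he, h1, rfl⟩
    obtain ⟨A, h2, rfl⟩ := mem_items.1 he
    refine ⟨A, h2, rfl, ?_⟩
    simp only [Option.some_inj, Tok.sign.injEq] at h1
    simp [← h1]
  · rintro ⟨A, h1, rfl, h2⟩
    refine ⟨_, mem_items.2 ⟨A, h1, rfl⟩, ?_, rfl⟩
    cases b <;> simp_all

theorem block_certificate {u : List Tok} :
    Block (certificate F E) u ↔ ∃ w A, (w, A) ∈ E ∧ u = flat (items E w) := by
  rw [certificate, Block, entry_append, entry_flat]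
  · simp only [List.mem_map, Prod.exists]
    constructor
    · rintro ⟨_, _, ⟨w, ⟨_, A, h1, rfl⟩, h2⟩, -, rfl⟩
      exact ⟨_, A, h1, by simpa using (congrArg Prod.snd h2).symm⟩
    · rintro ⟨w, A, h1, rfl⟩
      exact ⟨_, _, ⟨w, ⟨w, A, h1, rfl⟩, rfl⟩, rfl, rfl⟩
  · rintro _ rfl; exact ⟨_, rfl, by simp⟩
  · intro e he
    obtain ⟨w, -, rfl⟩ := List.mem_map.1 he
    refine ⟨by simp, fun a ha => ?_⟩
    obtain ⟨e, he, ha⟩ := List.mem_flatMap.1 ha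
    obtain ⟨A, -, rfl⟩ := mem_items.1 he
    rcases List.mem_cons.1 ha with rfl | ha
    · simp
    · have := isSym_of_mem_enc ha
      cases a <;> simp_all [Tok.isSym]
  · rintro _ rfl; exact ⟨_, rfl, by simp⟩
  · intro a ha
    obtain ⟨e, he, ha⟩ := List.mem_flatMap.1 ha
    obtain ⟨A, -, rfl⟩ := List.mem_map.1 he
    rcases List.mem_cons.1 ha with rfl | ha
    · simp
    · have := isSym_of_mem_enc ha
      cases a <;> simp_all [Tok.isSym]

theorem line_certificate (hE : ∀ e ∈ E, e.2 ∈ F.subs) {s : List Tok} :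
    Line (certificate F E) s ↔ ∃ A ∈ F.subs, s = A.enc := by
  -- At the level of formulas the certificate is a single list in which the mark of a block has an
  -- empty text.
  have h : certificate F E = flat ((F.subs.map fun A => (.aux, A.enc)) ++
      (E.map Prod.fst).flatMap fun w => (.world, []) :: items E w) := by
    simp [certificate, flat, List.flatMap_assoc, List.flatMap_map]
  rw [h, Line, entry_flat]
  · constructor
    · rintro ⟨e, he, h1, rfl⟩
      rcases List.mem_append.1 he with he | he
      · obtain ⟨A, hA, rfl⟩ := List.mem_map.1 he
        exact ⟨A, hA, rfl⟩
      · obtain ⟨w, -, he⟩ := List.mem_flatMap.1 he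
        rcases List.mem_cons.1 he with rfl | he
        · simp [IsMark] at h1
        · obtain ⟨A, hA, rfl⟩ := mem_items.1 he
          exact ⟨A, hE _ hA, rfl⟩
    · rintro ⟨A, hA, rfl⟩
      exact ⟨_, List.mem_append_left _ (List.mem_map.2 ⟨A, hA, rfl⟩), .inl rfl, rfl⟩
  · rintro _ (rfl | ⟨b, rfl⟩)
    exacts [⟨_, rfl, rfl⟩, ⟨_, rfl, rfl⟩]
  · intro e he
    rcases List.mem_append.1 he with he | he
    · obtain ⟨A, -, rfl⟩ := List.mem_map.1 he
      exact ⟨rfl, fun a => isSym_of_mem_enc⟩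
    · obtain ⟨w, -, he⟩ := List.mem_flatMap.1 he
      rcases List.mem_cons.1 he with rfl | he
      · exact ⟨rfl, by simp⟩
      · obtain ⟨A, -, rfl⟩ := mem_items.1 he
        exact ⟨rfl, fun a => isSym_of_mem_enc⟩

theorem closed_certificate (hE : ∀ e ∈ E, e.2 ∈ F.subs) : Closed (certificate F E) := by
  intro s hs
  simp only [line_certificate hE] at hs ⊢
  obtain ⟨A, hA, rfl⟩ := hs
  cases A with
  | bot => exact .inl rfl
  | var n => exact .inr (.inl (isVarCode_enc n))
  | neg A => exact .inr (.inr (.inl ⟨rfl, A, neg_mem_subs hA, rfl⟩))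
  | and A B =>
    have := and_mem_subs hA
    exact .inr (.inr (.inr ⟨.inl rfl, _, ⟨A, this.1, rfl⟩, _, ⟨B, this.2, rfl⟩, by simp [enc_and]⟩))
  | cond A B =>
    have := cond_mem_subs hA
    exact .inr (.inr (.inr ⟨.inr rfl, _, ⟨A, this.1, rfl⟩, _, ⟨B, this.2, rfl⟩, by simp [enc_cond]⟩))

/-- The pairs whose evaluation is immediately reduced to that of another pair. -/
def Child (M : SelModel) : M.W × Form ℕ → M.W × Form ℕ → Prop
  | (_, .bot), _ => False
  | (_, .var _), _ => False
  | (w, .neg A), e => e = (w, A)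
  | (w, .and A B), e => e = (w, A) ∨ e = (w, B)
  | (w, .cond A B), e => ∃ u, M.sel w {v | M.Holds v A} = some u ∧ (e = (u, A) ∨ e = (u, B))

/-- Closure under `Child` gives the Boolean conditions and the presence of the selected world. The
hypothesis `hs` provides separating blocks for antecedents with different truth sets. -/
theorem isHintikka_certificate {i : Bool} (hM : i = true → M.Identity)
    (hE : ∀ e ∈ E, e.2 ∈ F.subs) (hc : ∀ e ∈ E, ∀ e', Child M e e' → e' ∈ E)
    (hs : ∀ A ∈ F.subs, ∀ B ∈ F.subs, (∃ w, M.Holds w A ∧ ¬ M.Holds w B) →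
      ∃ w, M.Holds w A ∧ ¬ M.Holds w B ∧ (w, A) ∈ E ∧ (w, B) ∈ E)
    {u : List Tok} (hu : Block (certificate F E) u) : IsHintikka i (certificate F E) u := by
  obtain ⟨w, A₀, -, rfl⟩ := block_certificate.1 hu
  have mem : ∀ {w A b}, (w, A) ∈ E → (M.Holds w A ↔ b = true) → Mem (flat (items E w)) b A.enc :=
    fun h h' => mem_block.2 ⟨_, h, rfl, h'⟩
  have line : ∀ {w A}, (w, A) ∈ E → Line (certificate F E) A.enc :=
    fun h => (line_certificate hE).2 ⟨_, hE _ h, rfl⟩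
  refine ⟨fun s h1 h2 => ?_, fun h => ?_, fun s h h' => ?_, fun s h h' => ?_, fun s h h' => ?_,
    fun s h h' => ?_, fun s h h' s₁ h1 s₂ h2 h3 => ?_⟩
  · obtain ⟨A, -, rfl, hA⟩ := mem_block.1 h1
    obtain ⟨B, -, hAB, hB⟩ := mem_block.1 h2
    obtain rfl := enc_injective hAB
    simp_all
  · obtain ⟨A, -, hA, hA'⟩ := mem_block.1 h
    obtain rfl : Form.bot = A := enc_injective hA
    simp [SelModel.Holds] at hA'
  · obtain ⟨A, hA, rfl, hA'⟩ := mem_block.1 h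
    obtain ⟨A, rfl⟩ := neg_of_head? h'
    exact mem (hc _ hA (w, A) rfl) (by simpa [SelModel.Holds] using hA')
  · obtain ⟨A, hA, rfl, hA'⟩ := mem_block.1 h
    obtain ⟨A, rfl⟩ := neg_of_head? h'
    exact mem (hc _ hA (w, A) rfl) (by simpa [SelModel.Holds] using hA')
  · obtain ⟨A, hA, rfl, hA'⟩ := mem_block.1 h
    obtain ⟨A, B, rfl⟩ := and_of_head? h'
    have h1 := hc _ hA (w, A) (.inl rfl)
    have h2 := hc _ hA (w, B) (.inr rfl)
    have h3 := hA'.2 rfl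
    exact ⟨_, line h1, _, line h2, by simp [enc_and], mem h1 (by simpa using h3.1),
      mem h2 (by simpa using h3.2)⟩
  · obtain ⟨A, hA, rfl, hA'⟩ := mem_block.1 h
    obtain ⟨A, B, rfl⟩ := and_of_head? h'
    have h1 := hc _ hA (w, A) (.inl rfl)
    have h2 := hc _ hA (w, B) (.inr rfl)
    refine ⟨_, line h1, _, line h2, by simp [enc_and], ?_⟩
    by_cases h3 : M.Holds w A
    · refine .inr (mem h2 (iff_of_false (fun h4 => ?_) (by simp)))
      simpa using hA'.1 ⟨h3, h4⟩
    · exact .inl (mem h1 (iff_of_false h3 (by simp)))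
  · obtain ⟨C, hC, rfl, hC'⟩ := mem_block.1 h
    obtain ⟨A, B, rfl⟩ := cond_of_head? h'
    obtain ⟨A', hA', rfl⟩ := (line_certificate hE).1 h1
    obtain ⟨B', -, rfl⟩ := (line_certificate hE).1 h2
    obtain ⟨rfl, rfl⟩ := eq_of_enc_append (show A.enc ++ B.enc = _ by simpa [enc_cond] using h3)
    obtain ⟨v, hv, hvB⟩ : ∃ v, M.sel w {v | M.Holds v A} = some v ∧ ¬ M.Holds v B := by
      simpa [SelModel.Holds] using hC'
    have hvA := hc _ hC (v, A) ⟨v, hv, .inl rfl⟩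
    have key : ∀ b, IsSuccessor i (certificate F E) (flat (items E w)) (flat (items E v)) A.enc b := by
      intro b s h4 h5 s₁ h6 s₂ h7 h8
      obtain ⟨D, hD, rfl, hD'⟩ := mem_block.1 h4
      obtain ⟨A', B', rfl⟩ := cond_of_head? h5
      obtain ⟨A'', hA'', rfl⟩ := (line_certificate hE).1 h6
      obtain ⟨B'', -, rfl⟩ := (line_certificate hE).1 h7
      obtain ⟨rfl, rfl⟩ := eq_of_enc_append (show A'.enc ++ B'.enc = _ by
        simpa [enc_cond] using h8)
      -- With equal truth sets both conditionals select the same world `v`; otherwise some block of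
      -- the certificate separates the antecedents.
      by_cases hAA : {v | M.Holds v A} = {v | M.Holds v A'}
      · rw [hAA] at hv
        have h9 := hc _ hD (v, A') ⟨v, hv, .inl rfl⟩
        have h10 := hc _ hD (v, B') ⟨v, hv, .inr rfl⟩
        refine .inr ⟨mem h10 (hD'.symm.trans ?_).symm, fun hi => mem h9 (by
          simpa using hM hi _ _ _ hv)⟩
        exact ⟨fun h => h v hv, fun h u hu => by
          obtain rfl := Option.some_inj.1 (hv.symm.trans hu); exact h⟩
      · refine .inl ?_
        have : (∃ w, M.Holds w A ∧ ¬ M.Holds w A') ∨ ∃ w, M.Holds w A' ∧ ¬ M.Holds w A := by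
          by_contra! hcon
          exact hAA (Set.ext fun v => ⟨hcon.1 v, hcon.2 v⟩)
        rcases this with h | h
        · obtain ⟨r, h9, h10, h11, h12⟩ := hs _ hA' _ hA'' h
          exact ⟨_, block_certificate.2 ⟨r, A, h11, rfl⟩, .inl ⟨mem h11 (by simpa using h9),
            mem h12 (by simpa using h10)⟩⟩
        · obtain ⟨r, h9, h10, h11, h12⟩ := hs _ hA'' _ hA' h
          exact ⟨_, block_certificate.2 ⟨r, A, h12, rfl⟩, .inr ⟨mem h12 (by simpa using h10),
            mem h11 (by simpa using h9)⟩⟩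
    exact ⟨_, block_certificate.2 ⟨v, A, hvA, rfl⟩, key true, key false⟩

/-- There are at most `n` subformulas and `k` blocks of at most `k` signed formulas; every formula
and every block is preceded by one mark. -/
theorem length_certificate_le (hE : ∀ e ∈ E, e.2 ∈ F.subs) {n k : ℕ} (hn : F.enc.length ≤ n)
    (hk : E.length ≤ k) :
    (certificate F E).length ≤ n * (n + 1) + k * (k * (n + 1) + 1) := by
  have h1 : ∀ w : M.W, (flat (items E w)).length ≤ k * (n + 1) := by
    intro w
    refine (length_flatMap_le (k := n + 1) fun e he => ?_).trans (Nat.mul_le_mul_right _ ?_)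
    · obtain ⟨A, hA, rfl⟩ := mem_items.1 he
      simpa using (length_enc_le (hE _ hA)).trans hn
    · rw [items, List.length_map]
      exact (List.length_filter_le _ _).trans hk
  rw [certificate, List.length_append]
  refine Nat.add_le_add ((length_flatMap_le (k := n + 1) fun e he => ?_).trans
    (Nat.mul_le_mul_right _ ?_)) ((length_flatMap_le (k := k * (n + 1) + 1) fun e he => ?_).trans
    (Nat.mul_le_mul_right _ ?_))
  · obtain ⟨A, hA, rfl⟩ := List.mem_map.1 he
    simpa using (length_enc_le hA).trans hn
  · rw [List.length_map]
    exact F.length_subs_le.trans hn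
  · obtain ⟨w, -, rfl⟩ := List.mem_map.1 he
    simpa using h1 w
  · simpa using hk

end Certificate

/-- The pairs that the evaluation of a formula at a world depends on. -/
def trace (M : SelModel) : M.W → Form ℕ → List (M.W × Form ℕ)
  | w, .bot => [(w, .bot)]
  | w, .var p => [(w, .var p)]
  | w, .neg A => (w, .neg A) :: trace M w A
  | w, .and A B => (w, .and A B) :: (trace M w A ++ trace M w B)
  | w, .cond A B => (w, .cond A B) ::
      (M.sel w {v | M.Holds v A}).elim [] fun u => trace M u A ++ trace M u B

theorem self_mem_trace (w : M.W) (A : Form ℕ) : (w, A) ∈ trace M w A := by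
  cases A <;> simp [trace]

/-- This is where `CEM` matters for the complexity: with at most one selected world, each occurrence
of a subformula is evaluated at most once. -/
theorem length_trace_le (A : Form ℕ) : ∀ w : M.W, (trace M w A).length ≤ A.subs.length := by
  induction A with
  | bot | var p => simp [trace, subs]
  | neg A ih => simpa [trace, subs] using ih
  | and A B ih ih' =>
    intro w
    have := ih w
    have := ih' w
    simp only [trace, subs, List.length_cons, List.length_append]
    omega
  | cond A B ih ih' =>
    intro w
    simp only [trace, subs, List.length_cons, List.length_append]
    cases M.sel w {v | M.Holds v A} with
    | none => simp
    | some u =>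
      have := ih u
      have := ih' u
      simp only [Option.elim_some, List.length_append]
      omega

theorem mem_subs_of_mem_trace (A : Form ℕ) :
    ∀ w : M.W, ∀ e ∈ trace M w A, e.2 ∈ A.subs := by
  induction A with
  | bot | var p => simp [trace, subs]
  | neg A ih =>
    intro w e he
    simp only [trace, subs, List.mem_cons] at he ⊢
    rcases he with rfl | he
    · exact .inl rfl
    · exact .inr (ih _ _ he)
  | and A B ih ih' =>
    intro w e he
    simp only [trace, subs, List.mem_cons, List.mem_append] at he ⊢
    rcases he with rfl | he | he
    · exact .inl rfl
    · exact .inr (.inl (ih _ _ he))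
    · exact .inr (.inr (ih' _ _ he))
  | cond A B ih ih' =>
    intro w e he
    simp only [trace, subs, List.mem_cons, List.mem_append] at he ⊢
    rcases he with rfl | he
    · exact .inl rfl
    · cases h : M.sel w {v | M.Holds v A} with
      | none => simp [h] at he
      | some u =>
        simp only [h, Option.elim_some, List.mem_append] at he
        rcases he with he | he
        · exact .inr (.inl (ih _ _ he))
        · exact .inr (.inr (ih' _ _ he))

theorem trace_child (A : Form ℕ) :
    ∀ w : M.W, ∀ e ∈ trace M w A, ∀ e', Child M e e' → e' ∈ trace M w A := by
  induction A with
  | bot | var p => simp [trace, Child]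
  | neg A ih =>
    intro w e he e' h
    simp only [trace, List.mem_cons] at he ⊢
    rcases he with rfl | he
    · rw [show e' = (w, A) from h]
      exact .inr (self_mem_trace _ _)
    · exact .inr (ih _ _ he _ h)
  | and A B ih ih' =>
    intro w e he e' h
    simp only [trace, List.mem_cons, List.mem_append] at he ⊢
    rcases he with rfl | he | he
    · rcases h with rfl | rfl
      · exact .inr (.inl (self_mem_trace _ _))
      · exact .inr (.inr (self_mem_trace _ _))
    · exact .inr (.inl (ih _ _ he _ h))
    · exact .inr (.inr (ih' _ _ he _ h))
  | cond A B ih ih' =>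
    intro w e he e' h
    simp only [trace, List.mem_cons] at he ⊢
    rcases he with rfl | he
    · obtain ⟨u, hu, rfl | rfl⟩ := h
      · simp [hu, self_mem_trace]
      · simp [hu, self_mem_trace]
    · cases hs : M.sel w {v | M.Holds v A} with
      | none => simp [hs] at he
      | some u =>
        simp only [hs, Option.elim_some, List.mem_append] at he ⊢
        rcases he with he | he
        · exact .inr (.inl (ih _ _ he _ h))
        · exact .inr (.inr (ih' _ _ he _ h))

open Classical in
/-- The evaluation of two formulas at a world where the first is true and the second is false. -/
noncomputable def separation (M : SelModel) (A B : Form ℕ) : List (M.W × Form ℕ) :=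
  if h : ∃ w, M.Holds w A ∧ ¬ M.Holds w B then trace M h.choose A ++ trace M h.choose B else []

theorem exists_refutation {i : Bool} (hM : i = true → M.Identity) {F : Form ℕ} {w : M.W}
    (hF : ¬ M.Holds w F) {n : ℕ} (hn : F.enc.length ≤ n) :
    ∃ c, Refutes i F.enc c ∧ c.length ≤ n * (n + 1) +
      (n + n * n * (n + n)) * ((n + n * n * (n + n)) * (n + 1) + 1) := by
  -- The evaluation of `F`, and for each pair of subformulas that of both at a separating world.
  -- This gives at most `n + n * n * (n + n)` pairs.
  let E := trace M w F ++ (F.subs ×ˢ F.subs).flatMap fun p => separation M p.1 p.2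
  have sub : ∀ e ∈ E, e.2 ∈ F.subs := by
    intro e he
    rcases List.mem_append.1 he with he | he
    · exact mem_subs_of_mem_trace _ _ _ he
    · obtain ⟨⟨A, B⟩, hp, he⟩ := List.mem_flatMap.1 he
      obtain ⟨hA, hB⟩ := List.pair_mem_product.1 hp
      rw [separation] at he
      split_ifs at he
      · rcases List.mem_append.1 he with he | he
        · exact subs_trans (mem_subs_of_mem_trace _ _ _ he) hA
        · exact subs_trans (mem_subs_of_mem_trace _ _ _ he) hB
      · simp at he
  have child : ∀ e ∈ E, ∀ e', Child M e e' → e' ∈ E := by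
    intro e he e' h
    rcases List.mem_append.1 he with he | he
    · exact List.mem_append_left _ (trace_child _ _ _ he _ h)
    · refine List.mem_append_right _ ?_
      obtain ⟨⟨A, B⟩, hp, he⟩ := List.mem_flatMap.1 he
      refine List.mem_flatMap.2 ⟨_, hp, ?_⟩
      rw [separation] at he ⊢
      split_ifs at he ⊢
      · rcases List.mem_append.1 he with he | he
        · exact List.mem_append_left _ (trace_child _ _ _ he _ h)
        · exact List.mem_append_right _ (trace_child _ _ _ he _ h)
      · simp at he
  have sep : ∀ A ∈ F.subs, ∀ B ∈ F.subs, (∃ w, M.Holds w A ∧ ¬ M.Holds w B) →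
      ∃ w, M.Holds w A ∧ ¬ M.Holds w B ∧ (w, A) ∈ E ∧ (w, B) ∈ E := by
    intro A hA B hB h
    have : ∀ e ∈ trace M h.choose A ++ trace M h.choose B, e ∈ E := fun e he =>
      List.mem_append_right _ (List.mem_flatMap.2 ⟨(A, B), List.pair_mem_product.2 ⟨hA, hB⟩, by
        rw [separation, dif_pos h]; exact he⟩)
    exact ⟨_, h.choose_spec.1, h.choose_spec.2,
      this _ (List.mem_append_left _ (self_mem_trace _ _)),
      this _ (List.mem_append_right _ (self_mem_trace _ _))⟩
  have len : ∀ A ∈ F.subs, ∀ u, (trace M u A).length ≤ n := fun A hA u =>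
    (length_trace_le A u).trans (A.length_subs_le.trans ((length_enc_le hA).trans hn))
  have hF' : (w, F) ∈ E := List.mem_append_left _ (self_mem_trace _ _)
  refine ⟨certificate F E, .inr ⟨closed_certificate sub, .inr ⟨fun u hu =>
    isHintikka_certificate hM sub child sep hu, _, block_certificate.2 ⟨w, F, hF', rfl⟩,
    mem_block.2 ⟨F, hF', rfl, by simpa using hF⟩⟩⟩, length_certificate_le sub hn ?_⟩
  rw [List.length_append]
  refine Nat.add_le_add (len _ F.self_mem_subs _) ((length_flatMap_le (k := n + n) ?_).trans
    (Nat.mul_le_mul_right _ ?_))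
  · rintro ⟨A, B⟩ hp
    obtain ⟨hA, hB⟩ := List.pair_mem_product.1 hp
    rw [separation]
    split_ifs
    · rw [List.length_append]
      exact Nat.add_le_add (len _ hA _) (len _ hB _)
    · simp
  · rw [List.length_product]
    have := F.length_subs_le.trans hn
    exact Nat.mul_le_mul this this

/-- Strings that do not code a formula have short refutations. -/
theorem exists_refutation_of_not_code (i : Bool) {x : List Sym} (hx : ∀ A : Form ℕ, A.encode ≠ x) :
    ∃ c, Refutes i (x.map Tok.sym) c ∧
      c.length ≤ (2 * x.length + 1) * (2 * x.length + 1 + 1) := by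
  by_cases h : (∃ a, (x.map Tok.sym).head? = some a ∧ a.digit = true) ∨ ¬ ClashFree (x.map Tok.sym)
  · exact ⟨[], .inl h, by simp⟩
  push Not at h
  obtain ⟨A, hA⟩ := exists_parse _ (x.map Tok.sym) le_rfl (by
    intro a ha
    obtain ⟨b, -, rfl⟩ := List.mem_map.1 ha
    rfl) ⟨h.2, by simpa using h.1⟩
  have hA' : A.enc ≠ x.map Tok.sym := fun h => hx A (map_sym_injective h)
  have h1 : (A.enc <+: x.map Tok.sym ∨ x.map Tok.sym <+: A.enc) ∧
      A.enc.length ≤ 2 * x.length + 1 := by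
    rcases hA with ⟨r, hr, -⟩ | ⟨h1, h2⟩
    · refine ⟨.inl ⟨r, hr.symm⟩, ?_⟩
      have := congrArg List.length hr
      rw [List.length_append, List.length_map] at this
      omega
    · exact ⟨.inr h1, by simpa using h2⟩
  -- No world is needed: the list of subformulas certifies that `A.enc` is a code, and the model is
  -- a dummy.
  refine ⟨certificate (M := canon i) A [], .inr ⟨closed_certificate (by simp), .inl ⟨A.enc,
    (line_certificate (by simp)).2 ⟨A, A.self_mem_subs, rfl⟩, hA', h1.1⟩⟩, ?_⟩
  simpa using length_certificate_le (M := canon i) (E := []) (F := A) (by simp) h1.2 le_rfl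

theorem inCoNP_provabilityProblem (i : Bool) :
    InCoNP (provabilityProblem (system i)) := by
  classical
  -- The bound for the code that refutes a non-code; it also bounds the length of the input itself.
  -- The factor `4` below is the number of bits per symbol.
  let P : Polynomial ℕ := 2 * .X + 1
  refine ⟨fun q => decide (Refutes i (q.1.map Tok.sym) (decode q.2)), 4 * (P * (P + 1) +
    (P + P * P * (P + P)) * ((P + P * P * (P + P)) * (P + 1) + 1)), ?_, fun x => ?_⟩
  · convert ProgPred.polyTime (ProgPred.refutes i)
  · have hP : P.eval x.length = 2 * x.length + 1 := by simp [P]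
    simp only [Polynomial.eval_mul, Polynomial.eval_add, hP, decide_eq_true_eq, Polynomial.eval_one,
      Polynomial.eval_ofNat]
    constructor
    · intro hx
      obtain ⟨c, hc, hl⟩ : ∃ c, Refutes i (x.map Tok.sym) c ∧ c.length ≤ (2 * x.length + 1) *
          (2 * x.length + 1 + 1) + (2 * x.length + 1 + (2 * x.length + 1) * (2 * x.length + 1) *
          (2 * x.length + 1 + (2 * x.length + 1))) * ((2 * x.length + 1 + (2 * x.length + 1) *
          (2 * x.length + 1) * (2 * x.length + 1 + (2 * x.length + 1))) *
          (2 * x.length + 1 + 1) + 1) := by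
        by_cases h : ∃ A : Form ℕ, A.encode = x
        · obtain ⟨A, rfl⟩ := h
          have hA : ¬ HDerivable (system i) A := fun h => hx ⟨A, rfl, h⟩
          obtain ⟨T, hT, hAT⟩ := exists_isWorld hA
          exact exists_refutation (M := canon i) (by rintro rfl; exact canon_identity)
            (mt (canon_holds A ⟨T, hT⟩).1 hAT) (by simp [enc]; omega)
        · push Not at h
          obtain ⟨c, h1, h2⟩ := exists_refutation_of_not_code i h
          exact ⟨c, h1, h2.trans (Nat.le_add_right _ _)⟩
      obtain ⟨w, rfl, hw⟩ := exists_decode c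
      exact ⟨w, by rw [hw]; exact Nat.mul_le_mul_left _ hl, hc⟩
    · rintro ⟨w, -, hw⟩ ⟨A, rfl, hA⟩
      exact not_derivable_of_refutes hw hA

end CondLogic

theorem mainTheorem9 :
    Complexity.InCoNP (CondLogic.provabilityProblem (CondLogic.CKCEM ℕ)) ∧
      Complexity.InCoNP (CondLogic.provabilityProblem (CondLogic.CKIDCEM ℕ)) := by
  exact ⟨CondLogic.inCoNP_provabilityProblem false, CondLogic.inCoNP_provabilityProblem true⟩
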